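/- Identify $\mathbb R^2$ with $\mathbb C$ by $z=x_1+ix_2$, with $x^\perp=(-x_2,x_1)$, and define $$\mathcal T(f_1,f_2,f_3)(z)=\int_{\mathbb R}\int_{\mathbb R^2} f_1(x+z)\,f_2(\lambda x^\perp+z)\,\overline{f_3(x+\lambda x^\perp+z)}\,dx\,d\lambda ,\qquad \mathcal E(f_1,f_2,f_3,f_4)=\int_{\mathbb R^2}\mathcal T(f_1,f_2,f_3)\,\overline{f_4}\,dz .$$ For $n\in\mathbb N=\{0,1,2,\dots\}$ let $\phi_n(z)=(\pi\, n!)^{-1/2}z^n e^{-|z|^2/2}$, and for $n_1+n_2=n_3+n_4$ put $$\alpha_{n_1,n_2,n_3,n_4}=\pi\,\frac{(n_1+n_2)!}{2^{n_1+n_2}\sqrt{n_1!\,n_2!\,n_3!\,n_4!}} .$$ 1. For all $n_1,n_2,n_3\in\mathbb N$ and every $z$, the double integral defining $\mathcal T(\phi_{n_1},\phi_{n_2},\phi_{n_3})(z)$ converges absolutely. If $n_4:=n_1+n_2-n_3\ge 0$, then $\mathcal T(\phi_{n_1},\phi_{n_2},\phi_{n_3})=\alpha_{n_1,n_2,n_3,n_4}\,\phi_{n_4}$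 everywhere on $\mathbb C$; if $n_1+n_2<n_3$, then $\mathcal T(\phi_{n_1},\phi_{n_2},\phi_{n_3})=0$ everywhere on $\mathbb C$. 2. For all $n_1,n_2,n_3,n_4\in\mathbb N$ the integral defining $\mathcal E(\phi_{n_1},\phi_{n_2},\phi_{n_3},\phi_{n_4})$ converges absolutely, and $\mathcal E(\phi_{n_1},\phi_{n_2},\phi_{n_3},\phi_{n_4})$ equals $\alpha_{n_1,n_2,n_3,n_4}$ if $n_1+n_2=n_3+n_4$ and $0$ otherwise. 3. Let $\mathcal B$ be the Bargmann–Fock space, that is, the space of all $u\in L^2(\mathbb C)$ of the form $u(z)=F(z)e^{-|z|^2/2}$ with $F$ entire, and let $\Pi$ be the orthogonal projector of $L^2(\mathbb C)$ onto $\mathcal B$. For all $f_1,f_2,f_3\in\mathcal B$ the double integral defining $\mathcal T(f_1,f_2,f_3)(z)$ converges absolutely for every $z$, $f_1f_2\overline{f_3}\in L^2(\mathbb C)$, and $\mathcal T(f_1,f_2,f_3)=2\pi^2\,\Pi(f_1f_2\overline{f_3})$ almost everywhere; in particular $\mathcal T$ maps $\mathcal B^3$ into $\mathcal B$. Consequently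 a map $u:\mathbb R\to L^2(\mathbb C)$ with values in $\mathcal B$ solves the continuous resonant equation $i\partial_t u=\mathcal T(u,u,u)$ (time derivative in $L^2$) if and only if it solves the Lowest Landau Level equation $i\partial_t u=2\pi^2\,\Pi(|u|^2u)$. -/

import Mathlib

open MeasureTheory

noncomputable section

/-- The integrand `f₁(x + z) f₂(λ x^⊥ + z) conj (f₃(x + λ x^⊥ + z))` at `q = (λ, x)`.
The plane is identified with `ℂ`, so that `x^⊥ = (-x₂, x₁)` is `I * x`. -/
def crIntegrand (f₁ f₂ f₃ : ℂ → ℂ) (z : ℂ) (q : ℝ × ℂ) : ℂ :=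
  f₁ (q.2 + z) * f₂ ((q.1 : ℂ) * (Complex.I * q.2) + z) *
    (starRingEnd ℂ) (f₃ (q.2 + (q.1 : ℂ) * (Complex.I * q.2) + z))

/-- The trilinear operator `𝓣` of the continuous resonant equation. -/
def crT (f₁ f₂ f₃ : ℂ → ℂ) (z : ℂ) : ℂ :=
  ∫ l : ℝ, ∫ x : ℂ, crIntegrand f₁ f₂ f₃ z (l, x)

/-- `𝓔(f₁, f₂, f₃, f₄) = ⟨𝓣(f₁, f₂, f₃), f₄⟩` in `L²`, linear in the first slot. -/
def crE (f₁ f₂ f₃ f₄ : ℂ → ℂ) : ℂ :=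
  ∫ z : ℂ, crT f₁ f₂ f₃ z * (starRingEnd ℂ) (f₄ z)

/-- `φ_n(z) = (π n!)^{-1/2} z^n e^{-|z|²/2}`. -/
def bfPhi (n : ℕ) (z : ℂ) : ℂ :=
  ((1 / Real.sqrt (Real.pi * (n.factorial : ℝ)) : ℝ) : ℂ) * z ^ n *
    ((Real.exp (-‖z‖ ^ 2 / 2) : ℝ) : ℂ)

/-- The coefficient `α_{n₁,n₂,n₃,n₄}` on the resonant set `n₁ + n₂ = n₃ + n₄`. -/
def crAlpha (n₁ n₂ n₃ n₄ : ℕ) : ℝ :=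
  Real.pi * ((n₁ + n₂).factorial : ℝ) /
    (2 ^ (n₁ + n₂) * Real.sqrt ((n₁.factorial : ℝ) * (n₂.factorial : ℝ) *
      (n₃.factorial : ℝ) * (n₄.factorial : ℝ)))

/-- `L²` of the plane, with complex values and Lebesgue measure. -/
abbrev PlaneL2 : Type := Lp ℂ 2 (volume : Measure ℂ)

/-- The Bargmann-Fock space: the elements of `L²` of the form `F(z) e^{-|z|²/2}`, `F` entire. -/
def bargmannFock : Submodule ℂ PlaneL2 where
  carrier := {u | ∃ F : ℂ → ℂ, Differentiable ℂ F ∧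
    (u : ℂ → ℂ) =ᵐ[volume] fun z => F z * ((Real.exp (-‖z‖ ^ 2 / 2) : ℝ) : ℂ)}
  add_mem' := by
    rintro u v ⟨F, hF, hu⟩ ⟨G, hG, hv⟩
    refine ⟨F + G, hF.add hG, ?_⟩
    filter_upwards [hu, hv, Lp.coeFn_add u v] with z h1 h2 h3
    simp only [h3, Pi.add_apply, h1, h2, add_mul]
  zero_mem' := by
    refine ⟨0, differentiable_const 0, ?_⟩
    filter_upwards [Lp.coeFn_zero ℂ 2 (volume : Measure ℂ)] with z _
    simp
  smul_mem' := by
    rintro c u ⟨F, hF, hu⟩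
    refine ⟨c • F, hF.const_smul c, ?_⟩
    filter_upwards [hu, Lp.coeFn_smul c u] with z h1 h2
    simp only [h2, Pi.smul_apply, h1, smul_eq_mul, mul_assoc]

/-- `p = Π g`, where `Π` is the orthogonal projector of `L²` onto the Bargmann-Fock space. -/
def IsBargmannFockProj (g p : PlaneL2) : Prop :=
  p ∈ bargmannFock ∧ g - p ∈ bargmannFockᗮ

/-- `u : ℝ → L²` solves the continuous resonant equation `i ∂ₜ u = 𝓣(u, u, u)`. -/
def IsCRSolution (u : ℝ → PlaneL2) : Prop :=
  ∀ t : ℝ, ∃ u' : PlaneL2, HasDerivAt u u' t ∧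
    ((Complex.I • u' : PlaneL2) : ℂ → ℂ) =ᵐ[volume] crT (u t) (u t) (u t)

/-- `u : ℝ → L²` solves the Lowest Landau Level equation `i ∂ₜ u = c Π(|u|² u)`
with coupling constant `c`; here `N = |u|² u` and `p = Π N`. -/
def IsLLLSolution (c : ℝ) (u : ℝ → PlaneL2) : Prop :=
  ∀ t : ℝ, ∃ u' N p : PlaneL2, HasDerivAt u u' t ∧
    ((N : ℂ → ℂ) =ᵐ[volume] fun z => ((‖u t z‖ ^ 2 : ℝ) : ℂ) * u t z) ∧
    IsBargmannFockProj N p ∧ Complex.I • u' = (c : ℂ) • p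

end

/-! ### Mean values of entire functions and affine changes of variable in the plane. -/

section PlaneMeanValue

/-! Write `f_j = F_j e^{-|·|²/2}` with `F_j` entire. The points `x + z`, `λx^⊥ + z`, `w = x + λx^⊥ +
z` and `z` form a rectangle, so the Gaussian factors combine to `e^{-|w|²} e^{-|z|²/2}`. For fixed
`λ` take `w = (1 + iλ)x + z` as the variable: the Jacobian is the Cauchy weight `1/(1 + λ²)`, and
the two remaining vertices are `(z+w)/2 ± ω(w-z)/2` with `ω = (1 - iλ)/(1 + iλ)` on the unit circle.
Integrating in `λ` is therefore averaging over that circle, and the mean value property leaves `π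
(F₁F₂)((z+w)/2)` (`IsFock.crT_eq`).

For monomials, the binomial theorem and the orthogonality of Gaussian moments finish the
computation. In general, `F₁F₂` is reproduced by the kernel `e^{2v ū}` for the weight `e^{-2|u|²}`.
At `v = (z+w)/2` this kernel factors as `e^{z ū} e^{w ū}`, and the `w`-integral reproduces the
conjugate of `F₃` (`IsFock.crT_eq_kernel`). What remains is the kernel form of `Π` applied to `f₁f₂
f̄₃`.

Absolute convergence, needed for every Fubini step, rests on the local bound of `|f|²` by its mass
on a unit disc (`norm_fockFun_sq_le_integral_closedBall`), which controls `f` on lines. -/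

theorem integral_circle_of_entire {H : ℂ → ℂ} (hH : Differentiable ℂ H) (w : ℂ) :
    ∫ θ in (0 : ℝ)..2 * Real.pi, H (Complex.exp (θ * Complex.I) * w) = 2 * Real.pi * H 0 := by
  have hd : Differentiable ℂ fun ζ : ℂ => H (ζ * w) := by fun_prop
  have h := (hd.diffContOnCl (s := Metric.ball 0 |1|)).circleAverage
  rw [Real.circleAverage_def] at h
  simp only [circleMap, zero_add, Complex.ofReal_one, one_mul, zero_mul] at h
  have hp : (2 * Real.pi : ℝ) ≠ 0 := by positivity
  rw [inv_smul_eq_iff₀ hp] at h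
  rw [h, Complex.real_smul]
  push_cast
  ring

theorem map_mul_add_volume {a : ℂ} (ha : a ≠ 0) (b : ℂ) :
    Measure.map (fun x : ℂ => a * x + b) volume
      = ENNReal.ofReal ((‖a‖ ^ 2)⁻¹) • (volume : Measure ℂ) := by
  have hdet : LinearMap.det (LinearMap.mulLeft ℝ a) = ‖a‖ ^ 2 := by
    have := Algebra.norm_complex_apply a
    rw [Algebra.norm_apply] at this
    rw [← Complex.normSq_eq_norm_sq, ← this]
    rfl
  have hmul : Measure.map (fun x : ℂ => a * x) volume
      = ENNReal.ofReal ((‖a‖ ^ 2)⁻¹) • (volume : Measure ℂ) := by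
    have h := Measure.map_linearMap_addHaar_eq_smul_addHaar (μ := (volume : Measure ℂ))
      (f := LinearMap.mulLeft ℝ a) (by rw [hdet]; positivity)
    rw [hdet, abs_of_nonneg (by positivity)] at h
    exact h
  have hcomp : (fun x : ℂ => a * x + b) = (fun y => y + b) ∘ fun x => a * x := rfl
  rw [hcomp, ← Measure.map_map (by fun_prop) (by fun_prop), hmul, Measure.map_smul,
    (measurePreserving_add_right volume b).map_eq]

theorem quasiMeasurePreserving_mul_add {a : ℂ} (ha : a ≠ 0) (b : ℂ) :
    Measure.QuasiMeasurePreserving (fun x : ℂ => a * x + b) volume volume :=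
  ⟨by fun_prop, by
    rw [map_mul_add_volume ha]
    exact Measure.smul_absolutelyContinuous⟩

theorem measurableEmbedding_mul_add {a : ℂ} (ha : a ≠ 0) (b : ℂ) :
    MeasurableEmbedding fun x : ℂ => a * x + b :=
  ((Homeomorph.mulLeft₀ a ha).trans (Homeomorph.addRight b)).measurableEmbedding

theorem integral_comp_mul_add_plane {E : Type*} [NormedAddCommGroup E] [NormedSpace ℝ E]
    {a : ℂ} (ha : a ≠ 0) (b : ℂ) (f : ℂ → E) :
    ∫ x : ℂ, f (a * x + b) = (‖a‖ ^ 2)⁻¹ • ∫ x, f x := by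
  rw [← (measurableEmbedding_mul_add ha b).integral_map, map_mul_add_volume ha, integral_smul_measure,
    ENNReal.toReal_ofReal (by positivity)]

theorem integrable_comp_mul_add_plane {E : Type*} [NormedAddCommGroup E]
    {a : ℂ} (ha : a ≠ 0) (b : ℂ) {f : ℂ → E} :
    Integrable (fun x : ℂ => f (a * x + b)) ↔ Integrable f := by
  have h := (measurableEmbedding_mul_add ha b).integrable_map_iff (μ := volume) (g := f)
  rw [map_mul_add_volume ha, integrable_smul_measure (by simp; exact ha)
    ENNReal.ofReal_ne_top] at h
  exact h.symm

/-- Integrating an entire function against a radial weight only sees its value at the origin. -/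
theorem integral_entire_mul_radial {H : ℂ → ℂ} (hH : Differentiable ℂ H) {r : ℝ → ℂ}
    (hr : Measurable r) (hi : Integrable fun w : ℂ => H w * r ‖w‖) :
    ∫ w : ℂ, H w * r ‖w‖ = H 0 * ∫ w : ℂ, r ‖w‖ := by
  set μ : Measure ℝ := volume.restrict (Set.Ioc 0 (2 * Real.pi))
  have hne : ∀ θ : ℝ, Complex.exp (θ * Complex.I) ≠ 0 := fun θ => Complex.exp_ne_zero _
  have hno : ∀ θ : ℝ, ‖Complex.exp (θ * Complex.I)‖ = 1 := fun θ => Complex.norm_exp_ofReal_mul_I θ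
  have hrot : ∀ θ : ℝ, (fun w : ℂ => H (Complex.exp (θ * Complex.I) * w) * r ‖w‖)
      = fun w => (fun v => H v * r ‖v‖) (Complex.exp (θ * Complex.I) * w + 0) := by
    intro θ; funext w; simp [hno]
  have hc := hH.continuous
  -- Rotations preserve both the area and the weight, so the integral equals its average over `θ`;
  -- Fubini then puts the circular mean of `H` inside.
  have hint : Integrable (fun q : ℝ × ℂ => H (Complex.exp (q.1 * Complex.I) * q.2) * r ‖q.2‖)
      (μ.prod volume) := by
    rw [integrable_prod_iff]
    · refine ⟨Filter.Eventually.of_forall fun θ => ?_, ?_⟩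
      · simp only [hrot θ]
        exact (integrable_comp_mul_add_plane (hne θ) 0).2 hi
      · have : ∀ θ : ℝ, ∫ w : ℂ, ‖H (Complex.exp (θ * Complex.I) * w) * r ‖w‖‖
            = ∫ w : ℂ, ‖H w * r ‖w‖‖ := by
          intro θ
          have h := integral_comp_mul_add_plane (hne θ) 0 fun v => ‖H v * r ‖v‖‖
          rw [hno] at h
          simpa [hno] using h
        simp only [this]
        exact integrable_const _
    · refine AEStronglyMeasurable.mul (Continuous.aestronglyMeasurable (by fun_prop)) ?_
      exact (hr.comp (by fun_prop)).aestronglyMeasurable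
  have hswap := integral_integral_swap
    (f := fun (θ : ℝ) (w : ℂ) => H (Complex.exp (θ * Complex.I) * w) * r ‖w‖) hint
  have hl : ∀ θ : ℝ, ∫ w : ℂ, H (Complex.exp (θ * Complex.I) * w) * r ‖w‖
      = ∫ w : ℂ, H w * r ‖w‖ := by
    intro θ
    have h := integral_comp_mul_add_plane (hne θ) 0 fun v => H v * r ‖v‖
    rw [hno] at h
    simpa [hno] using h
  have hm : ∀ w : ℂ, ∫ θ : ℝ, H (Complex.exp (θ * Complex.I) * w) * r ‖w‖ ∂μ
      = 2 * Real.pi * (H 0 * r ‖w‖) := by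
    intro w
    rw [integral_mul_const, ← intervalIntegral.integral_of_le (by positivity),
      integral_circle_of_entire hH w]
    ring
  simp only [hl, hm, integral_const_mul] at hswap
  have hp : (2 * Real.pi : ℂ) ≠ 0 := by
    exact_mod_cast (by positivity : (2 * Real.pi : ℝ) ≠ 0)
  rw [integral_const] at hswap
  simp only [μ, Complex.real_smul, measureReal_restrict_apply_univ, Real.volume_real_Ioc,
    sub_zero, max_eq_left (by positivity : (0 : ℝ) ≤ 2 * Real.pi)] at hswap
  push_cast at hswap
  exact mul_left_cancel₀ hp hswap

/-- The Cayley transform carries the Cauchy measure to arc length on the circle. -/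
theorem integral_cayley_of_entire {h : ℂ → ℂ} (hh : Differentiable ℂ h) :
    ∫ l : ℝ, (((1 + l ^ 2)⁻¹ : ℝ) : ℂ) * h ((1 - l * Complex.I) / (1 + l * Complex.I))
      = Real.pi * h 0 := by
  set g : ℝ → ℂ := fun l =>
    (((1 + l ^ 2)⁻¹ : ℝ) : ℂ) * h ((1 - l * Complex.I) / (1 + l * Complex.I))
  have hcos : ∀ x ∈ Set.Ioo (-(Real.pi / 2)) (Real.pi / 2), Real.cos x ≠ 0 :=
    fun x hx => (Real.cos_pos_of_mem_Ioo hx).ne'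
  have h1 := integral_image_eq_integral_abs_deriv_smul (F := ℂ) (f := Real.tan)
    (f' := fun x => 1 / Real.cos x ^ 2) (s := Set.Ioo (-(Real.pi / 2)) (Real.pi / 2))
    measurableSet_Ioo (fun x hx => (Real.hasDerivAt_tan (hcos x hx)).hasDerivWithinAt)
    Real.injOn_tan g
  rw [Real.image_tan_Ioo, setIntegral_univ] at h1
  -- Under `l = tan x` the Cauchy measure becomes `dx` and the Cayley transform becomes `e^{-2ix}`.
  have h2 : ∀ x ∈ Set.Ioo (-(Real.pi / 2)) (Real.pi / 2),
      |1 / Real.cos x ^ 2| • g (Real.tan x) = h (Complex.exp ((-2 * x : ℝ) * Complex.I) * 1) := by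
    intro x hx
    have hc := hcos x hx
    have hcC : (Complex.cos x) ≠ 0 := by rw [← Complex.ofReal_cos]; exact_mod_cast hc
    have hE : ∀ y : ℂ, Complex.exp (y * Complex.I) ≠ 0 := fun y => Complex.exp_ne_zero _
    have harg : (1 - (Real.tan x : ℂ) * Complex.I) / (1 + (Real.tan x : ℂ) * Complex.I)
        = Complex.exp ((-2 * x : ℝ) * Complex.I) := by
      have e1 : 1 - (Real.tan x : ℂ) * Complex.I
          = Complex.exp ((-x : ℂ) * Complex.I) / Complex.cos x := by
        rw [Complex.exp_mul_I, Complex.ofReal_tan, Complex.tan_eq_sin_div_cos, Complex.cos_neg,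
          Complex.sin_neg]
        field_simp
        ring
      have e2 : 1 + (Real.tan x : ℂ) * Complex.I
          = Complex.exp ((x : ℂ) * Complex.I) / Complex.cos x := by
        rw [Complex.exp_mul_I, Complex.ofReal_tan, Complex.tan_eq_sin_div_cos]
        field_simp
      rw [e1, e2, div_div_div_cancel_right₀ hcC, ← Complex.exp_sub]
      congr 1
      push_cast
      ring
    have hfac : |1 / Real.cos x ^ 2| * (1 + Real.tan x ^ 2)⁻¹ = 1 := by
      rw [Real.inv_one_add_tan_sq hc, abs_of_nonneg (by positivity)]
      field_simp
    simp only [g]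
    rw [harg, Complex.real_smul, ← mul_assoc, ← Complex.ofReal_mul, hfac]
    simp
  rw [setIntegral_congr_fun measurableSet_Ioo h2, ← integral_Ioc_eq_integral_Ioo,
    ← intervalIntegral.integral_of_le (by linarith [Real.pi_pos]),
    intervalIntegral.integral_comp_mul_left
      (fun θ : ℝ => h (Complex.exp ((θ : ℝ) * Complex.I) * 1)) (by norm_num : (-2 : ℝ) ≠ 0)] at h1
  rw [h1]
  have hper : Function.Periodic (fun θ : ℝ => h (Complex.exp ((θ : ℝ) * Complex.I) * 1))
      (2 * Real.pi) := by
    intro θ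
    simp only [Complex.ofReal_add, add_mul, Complex.exp_add]
    push_cast
    simp [Complex.exp_two_pi_mul_I]
  have h3 := hper.intervalIntegral_add_eq (-Real.pi) 0
  rw [zero_add, integral_circle_of_entire hh 1] at h3
  rw [intervalIntegral.integral_symm, Complex.real_smul,
    show -2 * (Real.pi / 2) = -Real.pi by ring, show -2 * -(Real.pi / 2) = -Real.pi + 2 * Real.pi by ring,
    h3]
  push_cast
  ring

end PlaneMeanValue

/-! ### Pointwise and line bounds for Fock functions. -/

section FockFunctions

open scoped ComplexConjugate

/-- The function `F(z) e^{-|z|²/2}`. -/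
noncomputable def fockFun (F : ℂ → ℂ) (z : ℂ) : ℂ := F z * ((Real.exp (-‖z‖ ^ 2 / 2) : ℝ) : ℂ)

/-- `F` is entire and `F(z) e^{-|z|²/2}` is square integrable. -/
structure IsFock (F : ℂ → ℂ) : Prop where
  differentiable : Differentiable ℂ F
  memLp : MemLp (fockFun F) 2 (volume : Measure ℂ)

theorem norm_fockFun (F : ℂ → ℂ) (z : ℂ) : ‖fockFun F z‖ = ‖F z‖ * Real.exp (-‖z‖ ^ 2 / 2) := by
  rw [fockFun, norm_mul, Complex.norm_real, Real.norm_eq_abs, Real.abs_exp]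

theorem norm_eq_norm_fockFun_mul (F : ℂ → ℂ) (z : ℂ) :
    ‖F z‖ = ‖fockFun F z‖ * Real.exp (‖z‖ ^ 2 / 2) := by
  rw [norm_fockFun, mul_assoc, ← Real.exp_add]
  simp [neg_div]

theorem continuous_fockFun {F : ℂ → ℂ} (hF : Continuous F) : Continuous (fockFun F) := by
  unfold fockFun
  fun_prop

theorem norm_add_sq_plane (u y : ℂ) :
    ‖u + y‖ ^ 2 = ‖u‖ ^ 2 + ‖y‖ ^ 2 + 2 * (y * conj u).re := by
  simp only [← Complex.normSq_eq_norm_sq, Complex.normSq_apply, Complex.add_re, Complex.add_im,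
    Complex.mul_re, Complex.conj_re, Complex.conj_im]
  ring

/-- The twist `e^{-y ū}` absorbs the cross term of `|u + y|²`, so the entire function `H` has
modulus `|f(u+y)|² e^{|u|² + |y|²}`. Its mean over the unit disc is `H 0`; the constant is `e^{|y|²}
≤ e` over the area `π`. -/
theorem norm_fockFun_sq_le_integral_closedBall {F : ℂ → ℂ} (hF : Differentiable ℂ F) (u : ℂ) :
    ‖fockFun F u‖ ^ 2
      ≤ Real.exp 1 / Real.pi * ∫ y in Metric.closedBall u 1, ‖fockFun F y‖ ^ 2 := by
  set H : ℂ → ℂ := fun y => (F (u + y) * Complex.exp (-(y * conj u))) ^ 2 with hHdef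
  have hH : Differentiable ℂ H := by fun_prop
  set B : Set ℂ := Metric.closedBall 0 1
  set r : ℝ → ℂ := (Set.Iic 1).indicator fun _ => 1
  have hr : Measurable r := measurable_const.indicator measurableSet_Iic
  have hrB : ∀ G : ℂ → ℂ, (fun w : ℂ => G w * r ‖w‖) = B.indicator G := by
    intro G
    funext w
    by_cases h : ‖w‖ ≤ 1
    · have hw : w ∈ B := by simpa [B] using h
      simp [r, h, hw]
    · have hw : w ∉ B := by simpa [B] using h
      simp [r, h, hw]
  have hBm : MeasurableSet B := measurableSet_closedBall
  have hBc : IsCompact B := isCompact_closedBall 0 1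
  have key := integral_entire_mul_radial hH hr (by
    rw [hrB, integrable_indicator_iff hBm]
    exact hH.continuous.continuousOn.integrableOn_compact hBc)
  have hvol : ∫ w : ℂ, r ‖w‖ = Real.pi := by
    have h := hrB fun _ => 1
    simp only [one_mul] at h
    rw [h, integral_indicator hBm, setIntegral_const, Measure.real, Complex.volume_closedBall]
    simp
  rw [hrB, integral_indicator hBm, hvol] at key
  have hnorm : ∀ y, ‖H y‖ = ‖fockFun F (u + y)‖ ^ 2 * Real.exp (‖u‖ ^ 2 + ‖y‖ ^ 2) := by
    intro y
    have h1 : ‖Complex.exp (-(y * conj u))‖ = Real.exp (-(y * conj u).re) := by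
      rw [Complex.norm_exp, Complex.neg_re]
    rw [hHdef]
    simp only [norm_pow, norm_mul, h1]
    rw [norm_eq_norm_fockFun_mul, norm_add_sq_plane, mul_assoc, ← Real.exp_add, mul_pow,
      ← Real.exp_nat_mul]
    congr 2
    push_cast
    ring
  have hcf := continuous_fockFun hF.continuous
  have hle : ‖∫ y in B, H y‖
      ≤ ∫ y in B, ‖fockFun F (u + y)‖ ^ 2 * (Real.exp (‖u‖ ^ 2) * Real.exp 1) := by
    refine norm_integral_le_of_norm_le ?_ ?_
    · exact Continuous.continuousOn (by fun_prop) |>.integrableOn_compact hBc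
    · filter_upwards [ae_restrict_mem hBm] with y hy
      have hy1 : ‖y‖ ≤ 1 := by simpa [B] using hy
      rw [hnorm, Real.exp_add]
      gcongr
      nlinarith [norm_nonneg y]
  rw [key, integral_mul_const, norm_mul, hnorm, Complex.norm_real, Real.norm_eq_abs,
    abs_of_pos Real.pi_pos] at hle
  simp only [add_zero, norm_zero, ne_eq, OfNat.ofNat_ne_zero, not_false_eq_true, zero_pow] at hle
  have htrans : ∫ y in B, ‖fockFun F (u + y)‖ ^ 2
      = ∫ y in Metric.closedBall u 1, ‖fockFun F y‖ ^ 2 := by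
    rw [← integral_indicator hBm, ← integral_indicator measurableSet_closedBall]
    refine Eq.trans ?_ (integral_add_left_eq_self _ u)
    congr 1
    funext y
    by_cases h : y ∈ B
    · have h' : u + y ∈ Metric.closedBall u 1 := by simpa [B] using h
      simp [h, h']
    · have h' : u + y ∉ Metric.closedBall u 1 := by simpa [B] using h
      simp [h, h']
  rw [htrans] at hle
  have hE := Real.exp_pos (‖u‖ ^ 2)
  rw [div_mul_eq_mul_div, le_div_iff₀ Real.pi_pos]
  refine le_of_mul_le_mul_right ?_ hE
  linarith

theorem IsFock.continuous {F : ℂ → ℂ} (hF : IsFock F) : Continuous (fockFun F) :=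
  continuous_fockFun hF.differentiable.continuous

theorem IsFock.integrable_sq {F : ℂ → ℂ} (hF : IsFock F) :
    Integrable fun z => ‖fockFun F z‖ ^ 2 :=
  (memLp_two_iff_integrable_sq_norm hF.memLp.1).1 hF.memLp

theorem IsFock.norm_sq_le {F : ℂ → ℂ} (hF : IsFock F) (u : ℂ) :
    ‖fockFun F u‖ ^ 2 ≤ Real.exp 1 / Real.pi * ∫ y, ‖fockFun F y‖ ^ 2 := by
  refine (norm_fockFun_sq_le_integral_closedBall hF.differentiable u).trans ?_
  refine mul_le_mul_of_nonneg_left ?_ (by positivity)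
  exact setIntegral_le_integral hF.integrable_sq (Filter.Eventually.of_forall fun y => by positivity)

theorem IsFock.exists_bound {F : ℂ → ℂ} (hF : IsFock F) :
    ∃ M : ℝ, 0 ≤ M ∧ ∀ z, ‖fockFun F z‖ ≤ M := by
  refine ⟨Real.sqrt (Real.exp 1 / Real.pi * ∫ y, ‖fockFun F y‖ ^ 2), Real.sqrt_nonneg _, fun z => ?_⟩
  rw [← Real.sqrt_sq (norm_nonneg (fockFun F z))]
  exact Real.sqrt_le_sqrt (hF.norm_sq_le z)

/-- A Fock function is square integrable along every line, uniformly. -/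
theorem IsFock.line_bound {F : ℂ → ℂ} (hF : IsFock F) {v : ℂ} (hv : v ≠ 0) (z : ℂ) :
    Integrable (fun l : ℝ => ‖fockFun F (l * v + z)‖ ^ 2) ∧
    ∫ l : ℝ, ‖fockFun F (l * v + z)‖ ^ 2
      ≤ (2 * (Real.exp 1 / Real.pi) * ∫ y, ‖fockFun F y‖ ^ 2) * ‖v‖⁻¹ := by
  have hc := hF.continuous
  have hv0 : 0 < ‖v‖ := norm_pos_iff.2 hv
  set S : ℝ := ∫ y, ‖fockFun F y‖ ^ 2 with hS
  set c : ENNReal := ENNReal.ofReal (Real.exp 1 / Real.pi)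
  have hcT : c ≠ ⊤ := ENNReal.ofReal_ne_top
  -- Apply the disc bound at each point of the line and exchange integrals: a given `y` lies in the
  -- discs centred at parameters `l` from a set of diameter at most `2/|v|`. Working with `∫⁻` gives
  -- integrability and the bound together.
  set D : Set (ℝ × ℂ) := {q | ‖q.2 - (q.1 * v + z)‖ ≤ 1}
  have hD : MeasurableSet D := (isClosed_le (by fun_prop) continuous_const).measurableSet
  have hpt : ∀ l : ℝ, ENNReal.ofReal (‖fockFun F (l * v + z)‖ ^ 2)
      ≤ c * ∫⁻ y, D.indicator (fun q => ENNReal.ofReal (‖fockFun F q.2‖ ^ 2)) (l, y) := by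
    intro l
    have h := norm_fockFun_sq_le_integral_closedBall hF.differentiable (l * v + z)
    refine (ENNReal.ofReal_le_ofReal h).trans ?_
    rw [ENNReal.ofReal_mul (by positivity), ofReal_integral_eq_lintegral_ofReal
      hF.integrable_sq.integrableOn (Filter.Eventually.of_forall fun y => by positivity),
      ← lintegral_indicator measurableSet_closedBall]
    refine mul_le_mul_right (lintegral_mono fun y => ?_) c
    by_cases hy : y ∈ Metric.closedBall (l * v + z) 1
    · have : (l, y) ∈ D := by simpa [D, dist_eq_norm] using hy
      simp [hy, this]
    · simp [hy]
  have hm : Measurable (fun q : ℝ × ℂ =>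
      D.indicator (fun q => ENNReal.ofReal (‖fockFun F q.2‖ ^ 2)) q) :=
    (ENNReal.measurable_ofReal.comp (Continuous.measurable (by fun_prop))).indicator hD
  have hslice : ∀ y : ℂ, ∫⁻ l : ℝ, D.indicator (fun q => ENNReal.ofReal (‖fockFun F q.2‖ ^ 2)) (l, y)
      ≤ ENNReal.ofReal (2 * ‖v‖⁻¹) * ENNReal.ofReal (‖fockFun F y‖ ^ 2) := by
    intro y
    set A : Set ℝ := {l | (l, y) ∈ D}
    have hA : MeasurableSet A := measurable_prodMk_right hD
    have h1 : ∀ l : ℝ, D.indicator (fun q => ENNReal.ofReal (‖fockFun F q.2‖ ^ 2)) (l, y)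
        = A.indicator (fun _ => ENNReal.ofReal (‖fockFun F y‖ ^ 2)) l := fun l => rfl
    simp only [h1]
    rw [lintegral_indicator_const hA, mul_comm]
    gcongr
    refine (Real.volume_le_diam A).trans (Metric.ediam_le fun l hl m hm => ?_)
    rw [edist_dist]
    refine ENNReal.ofReal_le_ofReal ?_
    have hl1 : ‖y - (l * v + z)‖ ≤ 1 := hl
    have hm1 : ‖y - (m * v + z)‖ ≤ 1 := hm
    have h2 : ‖((l - m : ℝ) : ℂ) * v‖ ≤ 2 := by
      have : ((l - m : ℝ) : ℂ) * v = (y - (m * v + z)) - (y - (l * v + z)) := by push_cast; ring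
      rw [this]
      exact (norm_sub_le _ _).trans (by linarith)
    rw [norm_mul, Complex.norm_real] at h2
    rw [Real.dist_eq, ← Real.norm_eq_abs, ← div_eq_mul_inv, le_div_iff₀ hv0]
    exact h2
  have hbound : ∫⁻ l : ℝ, ENNReal.ofReal (‖fockFun F (l * v + z)‖ ^ 2)
      ≤ ENNReal.ofReal ((2 * (Real.exp 1 / Real.pi) * S) * ‖v‖⁻¹) := by
    calc _ ≤ ∫⁻ l : ℝ, c * ∫⁻ y,
          D.indicator (fun q => ENNReal.ofReal (‖fockFun F q.2‖ ^ 2)) (l, y) := lintegral_mono hpt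
      _ = c * ∫⁻ y, ∫⁻ l : ℝ,
          D.indicator (fun q => ENNReal.ofReal (‖fockFun F q.2‖ ^ 2)) (l, y) := by
        rw [lintegral_const_mul' _ _ hcT, lintegral_lintegral_swap
          (f := fun (l : ℝ) (y : ℂ) =>
            D.indicator (fun q => ENNReal.ofReal (‖fockFun F q.2‖ ^ 2)) (l, y)) hm.aemeasurable]
      _ ≤ c * ∫⁻ y, ENNReal.ofReal (2 * ‖v‖⁻¹) * ENNReal.ofReal (‖fockFun F y‖ ^ 2) := by
        gcongr with y
        exact hslice y
      _ = _ := by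
        rw [lintegral_const_mul' _ _ ENNReal.ofReal_ne_top, ← ofReal_integral_eq_lintegral_ofReal
          hF.integrable_sq (Filter.Eventually.of_forall fun y => by positivity),
          ← ENNReal.ofReal_mul (by positivity), ← ENNReal.ofReal_mul (by positivity), ← hS]
        congr 1
        ring
  have hSn : 0 ≤ S := integral_nonneg fun y => by positivity
  have hmeas : AEStronglyMeasurable (fun l : ℝ => ‖fockFun F (l * v + z)‖ ^ 2) volume :=
    Continuous.aestronglyMeasurable (by fun_prop)
  refine ⟨⟨hmeas, ?_⟩, ?_⟩
  · rw [hasFiniteIntegral_iff_ofReal (Filter.Eventually.of_forall fun y => by positivity)]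
    exact hbound.trans_lt ENNReal.ofReal_lt_top
  · rw [integral_eq_lintegral_of_nonneg_ae (Filter.Eventually.of_forall fun y => by positivity) hmeas]
    exact ENNReal.toReal_le_of_le_ofReal (by positivity) hbound

theorem integrable_inv_norm_mul_exp : Integrable fun x : ℂ => ‖x‖⁻¹ * Real.exp (-‖x‖ ^ 2) := by
  have h := Complex.integral_rpow_mul_exp_neg_rpow (p := 2) (q := -1) (by norm_num) (by norm_num)
  -- A non-integrable function has Bochner integral `0`, so a nonzero value proves integrability.
  refine Integrable.of_integral_ne_zero (μ := volume) ?_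
  simp only [Real.rpow_neg_one, Real.rpow_two] at h
  rw [h]
  have : 0 < Real.Gamma ((-1 + 2) / 2) := Real.Gamma_pos_of_pos (by norm_num)
  positivity

/-- Near the origin `f` is bounded and `1/|x|` is integrable in the plane; outside the unit disc
`1/|x| ≤ 1`. The weight `1/|x|` is what `IsFock.line_bound` produces for the line of direction
`x^⊥`. -/
theorem IsFock.integrable_sq_mul_inv_norm {F : ℂ → ℂ} (hF : IsFock F) (z : ℂ) :
    Integrable fun x : ℂ => ‖fockFun F (x + z)‖ ^ 2 * ‖x‖⁻¹ := by
  obtain ⟨M, hM, hb⟩ := hF.exists_bound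
  have hc := hF.continuous
  have h2 : Integrable fun x : ℂ => ‖fockFun F (x + z)‖ ^ 2 := hF.integrable_sq.comp_add_right z
  refine ((integrable_inv_norm_mul_exp.const_mul (M ^ 2 * Real.exp 1)).add h2).mono' ?_ ?_
  · exact Measurable.aestronglyMeasurable (by fun_prop)
  · refine Filter.Eventually.of_forall fun x => ?_
    rw [Real.norm_eq_abs, abs_of_nonneg (by positivity)]
    simp only [Pi.add_apply]
    rcases le_total ‖x‖ 1 with h | h
    · have e : 1 ≤ Real.exp 1 * Real.exp (-‖x‖ ^ 2) := by
        rw [← Real.exp_add]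
        exact Real.one_le_exp (by nlinarith [norm_nonneg x])
      have hm : ‖fockFun F (x + z)‖ ^ 2 ≤ M ^ 2 := by gcongr; exact hb _
      have : ‖fockFun F (x + z)‖ ^ 2 * ‖x‖⁻¹
          ≤ M ^ 2 * Real.exp 1 * (‖x‖⁻¹ * Real.exp (-‖x‖ ^ 2)) := by
        calc _ ≤ (M ^ 2 * 1) * ‖x‖⁻¹ := by rw [mul_one]; gcongr
          _ ≤ (M ^ 2 * (Real.exp 1 * Real.exp (-‖x‖ ^ 2))) * ‖x‖⁻¹ := by gcongr
          _ = _ := by ring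
      have : 0 ≤ ‖fockFun F (x + z)‖ ^ 2 := by positivity
      linarith
    · have : ‖fockFun F (x + z)‖ ^ 2 * ‖x‖⁻¹ ≤ ‖fockFun F (x + z)‖ ^ 2 * 1 := by
        gcongr
        exact inv_le_one_of_one_le₀ h
      have : 0 ≤ M ^ 2 * Real.exp 1 * (‖x‖⁻¹ * Real.exp (-‖x‖ ^ 2)) := by positivity
      linarith

end FockFunctions

/-! ### Absolute convergence and reduction of the trilinear operator to a planar integral. -/

section Trilinear

open scoped ComplexConjugate

theorem one_add_mul_I_ne_zero (l : ℝ) : (1 + l * Complex.I : ℂ) ≠ 0 := by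
  intro h
  have := congrArg Complex.re h
  simp at this

theorem norm_one_add_mul_I_sq (l : ℝ) : ‖(1 + l * Complex.I : ℂ)‖ ^ 2 = 1 + l ^ 2 := by
  rw [← Complex.normSq_eq_norm_sq, Complex.normSq_apply]
  simp
  ring

/-- The rectangle identity for the points `x + z`, `λ x^⊥ + z`, `x + λ x^⊥ + z` and `z`. -/
theorem norm_sq_rectangle (l : ℝ) (x z : ℂ) :
    ‖x + z‖ ^ 2 + ‖(l : ℂ) * (Complex.I * x) + z‖ ^ 2
      = ‖x + (l : ℂ) * (Complex.I * x) + z‖ ^ 2 + ‖z‖ ^ 2 := by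
  simp only [← Complex.normSq_eq_norm_sq, Complex.normSq_apply, Complex.add_re, Complex.add_im,
    Complex.mul_re, Complex.mul_im, Complex.I_re, Complex.I_im, Complex.ofReal_re,
    Complex.ofReal_im]
  ring

theorem crIntegrand_fockFun (F₁ F₂ F₃ : ℂ → ℂ) (z : ℂ) (l : ℝ) (x : ℂ) :
    crIntegrand (fockFun F₁) (fockFun F₂) (fockFun F₃) z (l, x)
      = F₁ (x + z) * F₂ (l * (Complex.I * x) + z) * (conj (F₃ (x + l * (Complex.I * x) + z)) *
          ((Real.exp (-‖x + l * (Complex.I * x) + z‖ ^ 2) : ℝ) : ℂ)) *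
          ((Real.exp (-‖z‖ ^ 2 / 2) : ℝ) : ℂ) := by
  have h : Real.exp (-‖x + z‖ ^ 2 / 2) * Real.exp (-‖(l : ℂ) * (Complex.I * x) + z‖ ^ 2 / 2) *
      Real.exp (-‖x + l * (Complex.I * x) + z‖ ^ 2 / 2)
      = Real.exp (-‖x + l * (Complex.I * x) + z‖ ^ 2) * Real.exp (-‖z‖ ^ 2 / 2) := by
    rw [← Real.exp_add, ← Real.exp_add, ← Real.exp_add]
    congr 1
    linarith [norm_sq_rectangle l x z]
  have hC := congrArg (fun t : ℝ => (t : ℂ)) h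
  simp only [Complex.ofReal_mul] at hC
  simp only [crIntegrand, fockFun, map_mul, Complex.conj_ofReal]
  linear_combination (F₁ (x + z) * F₂ (l * (Complex.I * x) + z) *
    conj (F₃ (x + l * (Complex.I * x) + z))) * hC

/-- The product is at most `|f₁f₂|² + |f₃|²`. Integrating the first term in `λ` first costs `1/|x|`;
integrating the second in `x` first leaves `1/(1 + λ²)`. -/
theorem IsFock.integrable_crIntegrand {F₁ F₂ F₃ : ℂ → ℂ} (h₁ : IsFock F₁) (h₂ : IsFock F₂)
    (h₃ : IsFock F₃) (z : ℂ) :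
    Integrable (crIntegrand (fockFun F₁) (fockFun F₂) (fockFun F₃) z) volume := by
  have c₁ := h₁.continuous
  have c₂ := h₂.continuous
  have c₃ := h₃.continuous
  have hA : Integrable (fun q : ℝ × ℂ =>
      ‖fockFun F₁ (q.2 + z)‖ ^ 2 * ‖fockFun F₂ (q.1 * (Complex.I * q.2) + z)‖ ^ 2)
      (volume.prod volume) := by
    rw [integrable_prod_iff' (Continuous.aestronglyMeasurable (by fun_prop))]
    have hx0 : ∀ᵐ x : ℂ, x ≠ 0 := by simp [ae_iff]
    constructor
    · filter_upwards [hx0] with x hx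
      exact (h₂.line_bound (v := Complex.I * x) (by simpa using hx) z).1.const_mul _
    · refine ((h₁.integrable_sq_mul_inv_norm z).mul_const
        (2 * (Real.exp 1 / Real.pi) * ∫ y, ‖fockFun F₂ y‖ ^ 2)).mono' ?_ ?_
      · exact (Continuous.aestronglyMeasurable
          (by fun_prop) : AEStronglyMeasurable (fun q : ℂ × ℝ => ‖‖fockFun F₁ (q.1 + z)‖ ^ 2 *
            ‖fockFun F₂ (q.2 * (Complex.I * q.1) + z)‖ ^ 2‖)
            (volume.prod volume)).integral_prod_right'
      · filter_upwards [hx0] with x hx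
        have hl := (h₂.line_bound (v := Complex.I * x) (by simpa using hx) z).2
        rw [Real.norm_eq_abs, abs_of_nonneg (integral_nonneg fun _ => norm_nonneg _)]
        simp only [norm_mul, norm_pow, norm_norm]
        rw [integral_const_mul, mul_assoc]
        refine mul_le_mul_of_nonneg_left ?_ (by positivity)
        rw [norm_mul, Complex.norm_I, one_mul] at hl
        linarith
  have hB : Integrable (fun q : ℝ × ℂ =>
      ‖fockFun F₃ (q.2 + q.1 * (Complex.I * q.2) + z)‖ ^ 2) (volume.prod volume) := by
    have hrw : ∀ (l : ℝ) (x : ℂ), x + l * (Complex.I * x) + z = (1 + l * Complex.I) * x + z := by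
      intro l x; ring
    rw [integrable_prod_iff (Continuous.aestronglyMeasurable (by fun_prop))]
    simp only [hrw, norm_pow, norm_norm]
    refine ⟨Filter.Eventually.of_forall fun l => ?_, ?_⟩
    · exact (integrable_comp_mul_add_plane (one_add_mul_I_ne_zero l) z
        (f := fun w => ‖fockFun F₃ w‖ ^ 2)).2 h₃.integrable_sq
    · have : ∀ l : ℝ, ∫ x : ℂ, ‖fockFun F₃ ((1 + l * Complex.I) * x + z)‖ ^ 2
          = (1 + l ^ 2)⁻¹ * ∫ w, ‖fockFun F₃ w‖ ^ 2 := by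
        intro l
        rw [integral_comp_mul_add_plane (one_add_mul_I_ne_zero l) z
          (fun w => ‖fockFun F₃ w‖ ^ 2), norm_one_add_mul_I_sq, smul_eq_mul]
      simp only [this]
      exact integrable_inv_one_add_sq.mul_const _
  rw [Measure.volume_eq_prod]
  refine (hA.add hB).mono' (Continuous.aestronglyMeasurable ?_)
    (Filter.Eventually.of_forall fun q => ?_)
  · unfold crIntegrand
    fun_prop
  · simp only [crIntegrand, norm_mul, RCLike.norm_conj, Pi.add_apply]
    rw [← mul_pow]
    nlinarith [sq_nonneg (‖fockFun F₁ (q.2 + z)‖ * ‖fockFun F₂ (q.1 * (Complex.I * q.2) + z)‖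
      - ‖fockFun F₃ (q.2 + q.1 * (Complex.I * q.2) + z)‖),
      sq_nonneg (‖fockFun F₁ (q.2 + z)‖ * ‖fockFun F₂ (q.1 * (Complex.I * q.2) + z)‖),
      sq_nonneg ‖fockFun F₃ (q.2 + q.1 * (Complex.I * q.2) + z)‖]

/-- With `z` and `w` fixed as opposite vertices of the rectangle, the other two are antipodal on the
circle with diameter `[z, w]`, and the `λ`-integral is a mean over that circle. -/
theorem IsFock.crT_eq {F₁ F₂ F₃ : ℂ → ℂ} (h₁ : IsFock F₁) (h₂ : IsFock F₂)
    (h₃ : IsFock F₃) (z : ℂ) :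
    crT (fockFun F₁) (fockFun F₂) (fockFun F₃) z
      = Real.pi * ((Real.exp (-‖z‖ ^ 2 / 2) : ℝ) : ℂ) *
        ∫ w : ℂ, F₁ ((z + w) / 2) * F₂ ((z + w) / 2) *
          (conj (F₃ w) * ((Real.exp (-‖w‖ ^ 2) : ℝ) : ℂ)) := by
  have hint := h₁.integrable_crIntegrand h₂ h₃ z
  set T := crIntegrand (fockFun F₁) (fockFun F₂) (fockFun F₃) z with hT
  have hTc : Continuous T := by
    have c₁ := h₁.continuous
    have c₂ := h₂.continuous
    have c₃ := h₃.continuous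
    rw [hT]
    unfold crIntegrand
    fun_prop
  have hne := one_add_mul_I_ne_zero
  have hsub : ∀ (l : ℝ) (x : ℂ),
      T (l, x) = (fun w => T (l, (w - z) / (1 + l * Complex.I))) ((1 + l * Complex.I) * x + z) := by
    intro l x
    have := hne l
    simp only [add_sub_cancel_right]
    rw [mul_div_cancel_left₀ _ this]
  rw [Measure.volume_eq_prod, integrable_prod_iff hTc.aestronglyMeasurable] at hint
  -- Integrability survives the change of variable slice by slice, which licenses integrating in `l`
  -- before `w`.
  have hK : Integrable (fun q : ℝ × ℂ =>
      (((1 + q.1 ^ 2)⁻¹ : ℝ) : ℂ) * T (q.1, (q.2 - z) / (1 + q.1 * Complex.I)))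
      (volume.prod volume) := by
    have hKc : Continuous (fun q : ℝ × ℂ =>
        (((1 + q.1 ^ 2)⁻¹ : ℝ) : ℂ) * T (q.1, (q.2 - z) / (1 + q.1 * Complex.I))) := by
      refine Continuous.mul (Complex.continuous_ofReal.comp ?_) (hTc.comp ?_)
      · exact Continuous.inv₀ (by fun_prop) fun q => by positivity
      · exact Continuous.prodMk continuous_fst
          (Continuous.div (by fun_prop) (by fun_prop) fun q => hne q.1)
    rw [integrable_prod_iff hKc.aestronglyMeasurable]
    constructor
    · filter_upwards [hint.1] with l hl
      rw [show (fun x => T (l, x)) = _ from funext (hsub l)] at hl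
      exact ((integrable_comp_mul_add_plane (hne l) z).1 hl).const_mul _
    · refine hint.2.congr (Filter.Eventually.of_forall fun l => ?_)
      beta_reduce
      rw [show (fun x => ‖T (l, x)‖) = _ from funext fun x => congrArg norm (hsub l x)]
      simp only [norm_mul, integral_const_mul]
      rw [integral_comp_mul_add_plane (hne l) z
        (fun w => ‖T (l, (w - z) / (1 + l * Complex.I))‖), norm_one_add_mul_I_sq, smul_eq_mul,
        Complex.norm_real, Real.norm_eq_abs, abs_of_pos (by positivity)]
  have hswap := integral_integral_swap (f := fun (l : ℝ) (w : ℂ) =>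
    (((1 + l ^ 2)⁻¹ : ℝ) : ℂ) * T (l, (w - z) / (1 + l * Complex.I))) hK
  have hleft : crT (fockFun F₁) (fockFun F₂) (fockFun F₃) z
      = ∫ l : ℝ, ∫ w : ℂ, (((1 + l ^ 2)⁻¹ : ℝ) : ℂ) * T (l, (w - z) / (1 + l * Complex.I)) := by
    unfold crT
    congr 1
    funext l
    rw [← hT, integral_const_mul, show (fun x => T (l, x)) = _ from funext (hsub l)]
    rw [integral_comp_mul_add_plane (hne l) z
      (fun w => T (l, (w - z) / (1 + l * Complex.I))), norm_one_add_mul_I_sq, Complex.real_smul]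
  rw [hleft, hswap, ← integral_const_mul]
  congr 1
  funext w
  have hcay := integral_cayley_of_entire
    (h := fun ω => F₁ ((z + w) / 2 + ω * ((w - z) / 2)) * F₂ ((z + w) / 2 - ω * ((w - z) / 2)))
    (by have d₁ := h₁.differentiable
        have d₂ := h₂.differentiable
        fun_prop)
  have hpt : ∀ l : ℝ, (((1 + l ^ 2)⁻¹ : ℝ) : ℂ) * T (l, (w - z) / (1 + l * Complex.I))
      = ((((1 + l ^ 2)⁻¹ : ℝ) : ℂ) * (F₁ ((z + w) / 2 + (1 - l * Complex.I) / (1 + l * Complex.I)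
          * ((w - z) / 2)) * F₂ ((z + w) / 2 - (1 - l * Complex.I) / (1 + l * Complex.I)
          * ((w - z) / 2)))) *
        (conj (F₃ w) * ((Real.exp (-‖w‖ ^ 2) : ℝ) : ℂ) *
          ((Real.exp (-‖z‖ ^ 2 / 2) : ℝ) : ℂ)) := by
    intro l
    have h0 := hne l
    have e1 : (w - z) / (1 + l * Complex.I) + z
        = (z + w) / 2 + (1 - l * Complex.I) / (1 + l * Complex.I) * ((w - z) / 2) := by
      field_simp
      ring
    have e2 : (l : ℂ) * (Complex.I * ((w - z) / (1 + l * Complex.I))) + z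
        = (z + w) / 2 - (1 - l * Complex.I) / (1 + l * Complex.I) * ((w - z) / 2) := by
      field_simp
      ring
    have e3 : (w - z) / (1 + l * Complex.I) + l * (Complex.I * ((w - z) / (1 + l * Complex.I))) + z
        = w := by
      field_simp
      ring
    rw [hT, crIntegrand_fockFun, e1, e2, e3]
    ring
  simp only [hpt]
  rw [integral_mul_const, hcay]
  simp only [zero_mul, add_zero, sub_zero]
  ring

/-! Replacing functions by almost everywhere equal ones. -/

/-- At `l = 0` the second argument is constantly `z`, where an almost everywhere class has no value;
for `l ≠ 0` all three arguments are invertible affine maps of `x`. -/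
theorem crIntegrand_slice_ae_eq {f₁ f₂ f₃ g₁ g₂ g₃ : ℂ → ℂ} (h₁ : f₁ =ᵐ[volume] g₁)
    (h₂ : f₂ =ᵐ[volume] g₂) (h₃ : f₃ =ᵐ[volume] g₃) (z : ℂ) {l : ℝ} (hl : l ≠ 0) :
    (fun x => crIntegrand f₁ f₂ f₃ z (l, x)) =ᵐ[volume]
      fun x => crIntegrand g₁ g₂ g₃ z (l, x) := by
  have q₁ := (quasiMeasurePreserving_mul_add one_ne_zero z).ae_eq_comp h₁
  have q₂ := (quasiMeasurePreserving_mul_add (a := l * Complex.I) (by simpa using hl) z).ae_eq_comp h₂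
  have q₃ := (quasiMeasurePreserving_mul_add (one_add_mul_I_ne_zero l) z).ae_eq_comp h₃
  filter_upwards [q₁, q₂, q₃] with x e₁ e₂ e₃
  simp only [Function.comp_apply] at e₁ e₂ e₃
  rw [one_mul] at e₁
  rw [mul_assoc] at e₂
  rw [add_mul, one_mul, mul_assoc] at e₃
  simp only [crIntegrand, e₁, e₂, e₃]

theorem crT_congr_ae {f₁ f₂ f₃ g₁ g₂ g₃ : ℂ → ℂ} (h₁ : f₁ =ᵐ[volume] g₁)
    (h₂ : f₂ =ᵐ[volume] g₂) (h₃ : f₃ =ᵐ[volume] g₃) (z : ℂ) :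
    crT f₁ f₂ f₃ z = crT g₁ g₂ g₃ z := by
  refine integral_congr_ae ?_
  have h0 : ∀ᵐ l : ℝ, l ≠ 0 := by simp [ae_iff]
  filter_upwards [h0] with l hl
  exact integral_congr_ae (crIntegrand_slice_ae_eq h₁ h₂ h₃ z hl)

theorem crIntegrand_ae_eq {f₁ f₂ f₃ g₁ g₂ g₃ : ℂ → ℂ} (h₁ : f₁ =ᵐ[volume] g₁)
    (h₂ : f₂ =ᵐ[volume] g₂) (h₃ : f₃ =ᵐ[volume] g₃)
    (mf₁ : Measurable f₁) (mf₂ : Measurable f₂) (mf₃ : Measurable f₃)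
    (mg₁ : Measurable g₁) (mg₂ : Measurable g₂) (mg₃ : Measurable g₃) (z : ℂ) :
    crIntegrand f₁ f₂ f₃ z =ᵐ[volume] crIntegrand g₁ g₂ g₃ z := by
  have hset : MeasurableSet {q : ℝ × ℂ | crIntegrand f₁ f₂ f₃ z q = crIntegrand g₁ g₂ g₃ z q} := by
    refine measurableSet_eq_fun ?_ ?_ <;>
    · unfold crIntegrand
      exact ((Measurable.comp ‹_› (by fun_prop)).mul (Measurable.comp ‹_› (by fun_prop))).mul
        (Complex.continuous_conj.measurable.comp (Measurable.comp ‹_› (by fun_prop)))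
  rw [Filter.EventuallyEq, Measure.volume_eq_prod, Measure.ae_prod_iff_ae_ae hset]
  have h0 : ∀ᵐ l : ℝ, l ≠ 0 := by simp [ae_iff]
  filter_upwards [h0] with l hl
  exact crIntegrand_slice_ae_eq h₁ h₂ h₃ z hl

end Trilinear

/-! ### Reproducing kernels and the kernel formula for the trilinear operator. -/

section Reproducing

open scoped ComplexConjugate

theorem integral_exp_neg_mul_norm_sq {a : ℝ} (ha : 0 < a) :
    ∫ w : ℂ, Real.exp (-a * ‖w‖ ^ 2) = Real.pi / a := by
  rw [GaussianFourier.integral_rexp_neg_mul_sq_norm ha, Complex.finrank_real_complex]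
  norm_num

theorem integrable_exp_neg_mul_norm_sq {a : ℝ} (ha : 0 < a) :
    Integrable fun w : ℂ => Real.exp (-a * ‖w‖ ^ 2) :=
  Integrable.of_integral_ne_zero (by
    rw [integral_exp_neg_mul_norm_sq ha]
    positivity)

/-- The reproducing property of the Gaussian kernel `e^{a u w̄}`. -/
theorem integral_reproducing {a : ℝ} (ha : 0 < a) {F : ℂ → ℂ} (hF : Differentiable ℂ F) {C : ℝ}
    (hb : ∀ w, ‖F w‖ ≤ C * Real.exp (a / 2 * ‖w‖ ^ 2)) (u : ℂ) :
    ∫ w : ℂ, Complex.exp (a * u * conj w) * F w * ((Real.exp (-a * ‖w‖ ^ 2) : ℝ) : ℂ)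
      = (Real.pi / a : ℝ) * F u := by
  -- Translating by `u` turns the kernel times the Gaussian into `e^{-a w ū}` times a centred
  -- Gaussian, so the integral sees only `H 0 = F u`.
  set H : ℂ → ℂ := fun w => Complex.exp (-(a * w * conj u)) * F (w + u) with hHdef
  have hH : Differentiable ℂ H := by fun_prop
  have hHc := hH.continuous
  have hr : Measurable fun t : ℝ => ((Real.exp (-a * t ^ 2) : ℝ) : ℂ) := by fun_prop
  have hi : Integrable fun w : ℂ => H w * ((Real.exp (-a * ‖w‖ ^ 2) : ℝ) : ℂ) := by
    refine ((integrable_exp_neg_mul_norm_sq (half_pos ha)).const_mul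
      (C * Real.exp (a / 2 * ‖u‖ ^ 2))).mono' (Continuous.aestronglyMeasurable (by fun_prop))
      (Filter.Eventually.of_forall fun w => ?_)
    rw [norm_mul, norm_mul, Complex.norm_exp, Complex.norm_real, Real.norm_eq_abs, Real.abs_exp]
    have hre : (-(a * w * conj u)).re = -(a * (w * conj u).re) := by
      rw [Complex.neg_re, mul_assoc, Complex.re_ofReal_mul]
    rw [hre]
    calc _ ≤ Real.exp (-(a * (w * conj u).re)) * (C * Real.exp (a / 2 * ‖w + u‖ ^ 2)) *
          Real.exp (-a * ‖w‖ ^ 2) := by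
          gcongr
          exact hb _
      _ = C * (Real.exp (-(a * (w * conj u).re)) * Real.exp (a / 2 * ‖w + u‖ ^ 2) *
          Real.exp (-a * ‖w‖ ^ 2)) := by ring
      _ = C * (Real.exp (a / 2 * ‖u‖ ^ 2) * Real.exp (-(a / 2) * ‖w‖ ^ 2)) := by
          rw [← Real.exp_add, ← Real.exp_add, ← Real.exp_add, add_comm w u, norm_add_sq_plane]
          congr 2
          ring
      _ = _ := by ring
  have key := integral_entire_mul_radial hH hr hi
  have hg : ∫ w : ℂ, ((Real.exp (-a * ‖w‖ ^ 2) : ℝ) : ℂ) = (Real.pi / a : ℝ) := by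
    rw [integral_complex_ofReal, integral_exp_neg_mul_norm_sq ha]
  rw [hg] at key
  rw [← integral_add_right_eq_self _ u]
  have hpt : ∀ w : ℂ, Complex.exp (a * u * conj (w + u)) * F (w + u) *
      ((Real.exp (-a * ‖w + u‖ ^ 2) : ℝ) : ℂ) = H w * ((Real.exp (-a * ‖w‖ ^ 2) : ℝ) : ℂ) := by
    intro w
    have hn : ∀ v : ℂ, ((‖v‖ ^ 2 : ℝ) : ℂ) = v * conj v := by
      intro v; rw [Complex.mul_conj, Complex.normSq_eq_norm_sq]
    have he : Complex.exp (a * u * conj (w + u)) * ((Real.exp (-a * ‖w + u‖ ^ 2) : ℝ) : ℂ)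
        = Complex.exp (-(a * w * conj u)) * ((Real.exp (-a * ‖w‖ ^ 2) : ℝ) : ℂ) := by
      rw [Complex.ofReal_exp, Complex.ofReal_exp, ← Complex.exp_add, ← Complex.exp_add]
      congr 1
      rw [Complex.ofReal_mul, Complex.ofReal_mul, hn, hn, map_add]
      push_cast
      ring
    rw [hHdef]
    linear_combination F (w + u) * he
  simp only [hpt]
  rw [key, hHdef]
  simp
  ring

theorem IsFock.integral_reproducing {F : ℂ → ℂ} (hF : IsFock F) (u : ℂ) :
    ∫ w : ℂ, Complex.exp (u * conj w) * F w * ((Real.exp (-‖w‖ ^ 2) : ℝ) : ℂ) = Real.pi * F u := by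
  obtain ⟨M, -, hM⟩ := hF.exists_bound
  have h := _root_.integral_reproducing one_pos hF.differentiable (C := M) (fun w => by
    rw [norm_eq_norm_fockFun_mul, show (1 : ℝ) / 2 * ‖w‖ ^ 2 = ‖w‖ ^ 2 / 2 by ring]
    gcongr
    exact hM w) u
  simpa using h

theorem IsFock.crT_eq_kernel {F₁ F₂ F₃ : ℂ → ℂ} (h₁ : IsFock F₁) (h₂ : IsFock F₂)
    (h₃ : IsFock F₃) (z : ℂ) :
    crT (fockFun F₁) (fockFun F₂) (fockFun F₃) z
      = 2 * Real.pi * ((Real.exp (-‖z‖ ^ 2 / 2) : ℝ) : ℂ) *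
        ∫ u : ℂ, Complex.exp (z * conj u) * (F₁ u * F₂ u) * conj (F₃ u) *
          ((Real.exp (-2 * ‖u‖ ^ 2) : ℝ) : ℂ) := by
  obtain ⟨M₁, p₁, hM₁⟩ := h₁.exists_bound
  obtain ⟨M₂, p₂, hM₂⟩ := h₂.exists_bound
  obtain ⟨M₃, p₃, hM₃⟩ := h₃.exists_bound
  have c₁ := h₁.differentiable.continuous
  have c₂ := h₂.differentiable.continuous
  have c₃ := h₃.differentiable.continuous
  have hG : ∀ w, ‖F₁ w * F₂ w‖ ≤ M₁ * M₂ * Real.exp (‖w‖ ^ 2) := by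
    intro w
    rw [norm_mul, norm_eq_norm_fockFun_mul F₁, norm_eq_norm_fockFun_mul F₂]
    calc _ = ‖fockFun F₁ w‖ * ‖fockFun F₂ w‖ * (Real.exp (‖w‖ ^ 2 / 2) * Real.exp (‖w‖ ^ 2 / 2)) := by
          ring
      _ ≤ M₁ * M₂ * (Real.exp (‖w‖ ^ 2 / 2) * Real.exp (‖w‖ ^ 2 / 2)) := by
          gcongr
          · exact hM₁ w
          · exact hM₂ w
      _ = _ := by rw [← Real.exp_add]; ring_nf
  have hF₃ : ∀ w, ‖F₃ w‖ ≤ M₃ * Real.exp (‖w‖ ^ 2 / 2) := by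
    intro w
    rw [norm_eq_norm_fockFun_mul]
    gcongr
    exact hM₃ w
  -- The product `F₁F₂` grows up to `e^{|w|²}`, which is the growth admitted by the kernel with `a =
  -- 2`.
  have hrepG : ∀ v : ℂ, F₁ v * F₂ v = 2 / Real.pi *
      ∫ u : ℂ, Complex.exp (2 * v * conj u) * (F₁ u * F₂ u) *
        ((Real.exp (-2 * ‖u‖ ^ 2) : ℝ) : ℂ) := by
    intro v
    have h := _root_.integral_reproducing (a := 2) (F := fun w => F₁ w * F₂ w) two_pos
      (h₁.differentiable.mul h₂.differentiable) (C := M₁ * M₂)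
      (fun w => by simpa using hG w) v
    push_cast at h ⊢
    rw [h]
    have : (Real.pi : ℂ) ≠ 0 := by exact_mod_cast Real.pi_ne_zero
    field_simp
  set J : ℂ → ℂ → ℂ := fun w u =>
    Complex.exp ((z + w) * conj u) * (F₁ u * F₂ u) * ((Real.exp (-2 * ‖u‖ ^ 2) : ℝ) : ℂ) *
      (conj (F₃ w) * ((Real.exp (-‖w‖ ^ 2) : ℝ) : ℂ)) with hJ
  have hint : Integrable (Function.uncurry J) (volume.prod volume) := by
    have hdom := ((integrable_exp_neg_mul_norm_sq (a := 1 / 6) (by norm_num)).mul_prod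
      (integrable_exp_neg_mul_norm_sq (a := 1 / 8) (by norm_num))).const_mul
      (M₁ * M₂ * M₃ * Real.exp (2 * ‖z‖ ^ 2))
    refine hdom.mono' (Continuous.aestronglyMeasurable ?_)
      (Filter.Eventually.of_forall fun q => ?_)
    · rw [hJ]
      unfold Function.uncurry
      fun_prop
    · obtain ⟨w, u⟩ := q
      simp only [Function.uncurry_apply_pair, hJ, norm_mul (Complex.exp _ * _ * _),
        norm_mul (Complex.exp _ * _), norm_mul (Complex.exp _), norm_mul (conj _),
        RCLike.norm_conj, Complex.norm_real, Real.norm_eq_abs, Real.abs_exp, Complex.norm_exp]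
      have hre : ((z + w) * conj u).re ≤ (‖z‖ + ‖w‖) * ‖u‖ := by
        refine (Complex.re_le_norm _).trans ?_
        rw [norm_mul, RCLike.norm_conj]
        gcongr
        exact norm_add_le z w
      calc _ ≤ Real.exp ((‖z‖ + ‖w‖) * ‖u‖) * (M₁ * M₂ * Real.exp (‖u‖ ^ 2)) *
            Real.exp (-2 * ‖u‖ ^ 2) * (M₃ * Real.exp (‖w‖ ^ 2 / 2) * Real.exp (-‖w‖ ^ 2)) := by
            gcongr
            · exact hG u
            · exact hF₃ w
        _ = M₁ * M₂ * M₃ * (Real.exp ((‖z‖ + ‖w‖) * ‖u‖) * Real.exp (‖u‖ ^ 2) *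
            Real.exp (-2 * ‖u‖ ^ 2) * Real.exp (‖w‖ ^ 2 / 2) * Real.exp (-‖w‖ ^ 2)) := by ring
        _ = M₁ * M₂ * M₃ * Real.exp ((‖z‖ + ‖w‖) * ‖u‖ + ‖u‖ ^ 2 + -2 * ‖u‖ ^ 2 + ‖w‖ ^ 2 / 2
            + -‖w‖ ^ 2) := by simp only [Real.exp_add]
        _ ≤ M₁ * M₂ * M₃ * Real.exp (2 * ‖z‖ ^ 2 + (-(1 / 6) * ‖w‖ ^ 2 + -(1 / 8) * ‖u‖ ^ 2)) := by
            refine mul_le_mul_of_nonneg_left (Real.exp_le_exp.2 ?_) (by positivity)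
            -- The rates `1/6` and `1/8` come from `|z||u| ≤ 2|z|² + |u|²/8` and `|w||u| ≤ 3|u|²/4 +
            -- |w|²/3`.
            nlinarith [sq_nonneg (2 * ‖z‖ - ‖u‖ / 2), sq_nonneg (3 * ‖u‖ - 2 * ‖w‖)]
        _ = _ := by rw [Real.exp_add, Real.exp_add]; ring
  have hswap := integral_integral_swap hint
  have hw : ∀ w : ℂ, F₁ ((z + w) / 2) * F₂ ((z + w) / 2) *
      (conj (F₃ w) * ((Real.exp (-‖w‖ ^ 2) : ℝ) : ℂ)) = 2 / Real.pi * ∫ u, J w u := by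
    intro w
    rw [hJ, integral_mul_const, hrepG, show 2 * ((z + w) / 2) = z + w by ring]
    ring
  have hu : ∀ u : ℂ, ∫ w, J w u = Real.pi * (Complex.exp (z * conj u) * (F₁ u * F₂ u) *
      conj (F₃ u) * ((Real.exp (-2 * ‖u‖ ^ 2) : ℝ) : ℂ)) := by
    intro u
    have h3 := congrArg conj (h₃.integral_reproducing u)
    rw [← integral_conj] at h3
    simp only [map_mul, Complex.conj_ofReal, ← Complex.exp_conj, Complex.conj_conj] at h3
    have : ∀ w, J w u = (Complex.exp (z * conj u) * (F₁ u * F₂ u) *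
        ((Real.exp (-2 * ‖u‖ ^ 2) : ℝ) : ℂ)) * (Complex.exp (conj u * w) * conj (F₃ w) *
        ((Real.exp (-‖w‖ ^ 2) : ℝ) : ℂ)) := by
      intro w
      simp only [hJ, add_mul, Complex.exp_add, mul_comm w]
      ring
    simp only [this]
    rw [integral_const_mul, h3]
    ring
  rw [h₁.crT_eq h₂ h₃]
  simp only [hw]
  rw [integral_const_mul, hswap]
  simp only [hu]
  rw [integral_const_mul]
  have : (Real.pi : ℂ) ≠ 0 := by exact_mod_cast Real.pi_ne_zero
  field_simp

end Reproducing

/-! ### The orthogonal projector and the equivalence of the two equations. -/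

section Projection

open scoped ComplexConjugate

theorem exists_isFock_of_mem_bargmannFock {f : PlaneL2} (hf : f ∈ bargmannFock) :
    ∃ F : ℂ → ℂ, IsFock F ∧ (f : ℂ → ℂ) =ᵐ[volume] fockFun F := by
  obtain ⟨F, hF, h⟩ := hf
  exact ⟨F, ⟨hF, (memLp_congr_ae h).1 (Lp.memLp f)⟩, h⟩

theorem IsFock.toLp_mem_bargmannFock {F : ℂ → ℂ} (hF : IsFock F) :
    hF.memLp.toLp (fockFun F) ∈ bargmannFock :=
  ⟨F, hF.differentiable, hF.memLp.coeFn_toLp⟩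

theorem integral_norm_sq_eq_norm_sq {f : PlaneL2} {g : ℂ → ℂ} (h : (f : ℂ → ℂ) =ᵐ[volume] g) :
    ∫ z, ‖g z‖ ^ 2 = ‖f‖ ^ 2 := by
  have h1 : (inner ℂ f f : ℂ) = ((∫ z, ‖g z‖ ^ 2 : ℝ) : ℂ) := by
    rw [L2.inner_def, ← integral_complex_ofReal]
    refine integral_congr_ae ?_
    filter_upwards [h] with z hz
    rw [hz, inner_self_eq_norm_sq_to_K]
    simp
  rw [inner_self_eq_norm_sq_to_K] at h1
  exact Complex.ofReal_injective (h1.symm.trans (by simp))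

theorem fockFun_sub (F G : ℂ → ℂ) : fockFun (F - G) = fockFun F - fockFun G := by
  funext z
  simp [fockFun, sub_mul]

theorem norm_sub_le_of_fock {f g : PlaneL2} {F G : ℂ → ℂ} (hF : IsFock F) (hG : IsFock G)
    (hf : (f : ℂ → ℂ) =ᵐ[volume] fockFun F) (hg : (g : ℂ → ℂ) =ᵐ[volume] fockFun G) (z : ℂ) :
    ‖F z - G z‖
      ≤ Real.sqrt (Real.exp 1 / Real.pi) * Real.exp (‖z‖ ^ 2 / 2) * ‖f - g‖ := by
  have hFG : IsFock (F - G) :=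
    ⟨hF.differentiable.sub hG.differentiable, by rw [fockFun_sub]; exact hF.memLp.sub hG.memLp⟩
  have hae : ((f - g : PlaneL2) : ℂ → ℂ) =ᵐ[volume] fockFun (F - G) := by
    rw [fockFun_sub]
    exact (Lp.coeFn_sub f g).trans (hf.sub hg)
  have h := Real.sqrt_le_sqrt (hFG.norm_sq_le z)
  rw [integral_norm_sq_eq_norm_sq hae, Real.sqrt_sq (norm_nonneg _), Real.sqrt_mul (by positivity),
    Real.sqrt_sq (norm_nonneg _)] at h
  have h2 := norm_eq_norm_fockFun_mul (F - G) z
  rw [Pi.sub_apply] at h2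
  rw [h2]
  calc _ ≤ (Real.sqrt (Real.exp 1 / Real.pi) * ‖f - g‖) * Real.exp (‖z‖ ^ 2 / 2) := by gcongr
    _ = _ := by ring

open Filter Topology in
-- The pointwise bound turns `L²` convergence into locally uniform convergence of the entire
-- factors, whose limit is entire; an almost everywhere convergent subsequence identifies it with
-- the `L²` limit. Closedness makes the projector exist.
theorem isClosed_bargmannFock : IsClosed (bargmannFock : Set PlaneL2) := by
  rw [← isSeqClosed_iff_isClosed]
  intro u f hu hlim
  choose F hF hFu using fun n => exists_isFock_of_mem_bargmannFock (hu n)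
  set c : ℂ → ℝ := fun z => Real.sqrt (Real.exp 1 / Real.pi) * Real.exp (‖z‖ ^ 2 / 2) with hc
  have hcc : Continuous c := by fun_prop
  have hc0 : ∀ z, 0 ≤ c z := fun z => by positivity
  have hle : ∀ n m z, ‖F n z - F m z‖ ≤ c z * ‖u n - u m‖ := fun n m z =>
    norm_sub_le_of_fock (hF n) (hF m) (hFu n) (hFu m) z
  have hcau : ∀ z, ∃ l, Tendsto (fun n => F n z) atTop (𝓝 l) := by
    intro z
    apply cauchySeq_tendsto_of_complete
    have hcu := hlim.cauchySeq
    rw [Metric.cauchySeq_iff] at hcu ⊢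
    intro ε hε
    obtain ⟨N, hN⟩ := hcu (ε / (c z + 1)) (by have := hc0 z; positivity)
    refine ⟨N, fun m hm n hn => ?_⟩
    have h1 := hN m hm n hn
    rw [dist_eq_norm, lt_div_iff₀ (by linarith [hc0 z])] at h1
    rw [dist_eq_norm]
    refine (hle m n z).trans_lt (lt_of_le_of_lt ?_ h1)
    nlinarith [norm_nonneg (u m - u n)]
  choose G hG using hcau
  have hleG : ∀ n z, ‖F n z - G z‖ ≤ c z * ‖u n - f‖ := by
    intro n z
    refine le_of_tendsto_of_tendsto' ((tendsto_const_nhds.sub (hG z)).norm)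
      ((tendsto_const_nhds.sub hlim).norm.const_mul (c z)) fun m => hle n m z
  have hunif : TendstoLocallyUniformlyOn F G atTop Set.univ := by
    rw [tendstoLocallyUniformlyOn_iff_forall_isCompact isOpen_univ]
    intro K _ hK
    obtain ⟨A, hA⟩ := hK.exists_bound_of_continuousOn hcc.continuousOn
    rw [Metric.tendstoUniformlyOn_iff]
    intro ε hε
    have hz : Tendsto (fun n => |A| * ‖u n - f‖) atTop (𝓝 0) := by
      have := ((hlim.sub_const f).norm).const_mul |A|
      simpa using this
    filter_upwards [hz.eventually_lt_const hε] with n hn z hzK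
    rw [dist_comm, dist_eq_norm]
    refine (hleG n z).trans_lt (lt_of_le_of_lt ?_ hn)
    gcongr
    exact (le_abs_self _).trans ((hA z hzK).trans (le_abs_self A))
  have hGd : Differentiable ℂ G := by
    rw [← differentiableOn_univ]
    exact hunif.differentiableOn (Eventually.of_forall fun n => (hF n).differentiable.differentiableOn)
      isOpen_univ
  refine ⟨G, hGd, ?_⟩
  obtain ⟨ns, hns, hae⟩ := (tendstoInMeasure_of_tendsto_Lp hlim).exists_seq_tendsto_ae
  have hall : ∀ᵐ z, ∀ n, u n z = fockFun (F n) z := ae_all_iff.2 hFu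
  filter_upwards [hae, hall] with z h1 h2
  simp only [h2] at h1
  exact tendsto_nhds_unique h1 (((hG z).comp hns.tendsto_atTop).mul_const _)

theorem exists_isBargmannFockProj (g : PlaneL2) : ∃ p, IsBargmannFockProj g p := by
  have : CompleteSpace bargmannFock := isClosed_bargmannFock.completeSpace_coe
  exact ⟨bargmannFock.starProjection g, bargmannFock.starProjection_apply_mem g,
    bargmannFock.sub_starProjection_mem_orthogonal g⟩

theorem IsBargmannFockProj.unique {g p q : PlaneL2} (hp : IsBargmannFockProj g p)
    (hq : IsBargmannFockProj g q) : p = q := by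
  have h1 : p - q ∈ bargmannFock := bargmannFock.sub_mem hp.1 hq.1
  have h2 : p - q ∈ bargmannFockᗮ := by
    have := bargmannFockᗮ.sub_mem hq.2 hp.2
    rwa [sub_sub_sub_cancel_left] at this
  have h3 : p - q ∈ bargmannFock ⊓ bargmannFockᗮ := ⟨h1, h2⟩
  rw [Submodule.inf_orthogonal_eq_bot, Submodule.mem_bot] at h3
  exact sub_eq_zero.1 h3

/-- The squared modulus is `e^{|z|²} e^{-|w - z|²}`, a translated Gaussian. -/
theorem isFock_exp_mul_conj (z : ℂ) : IsFock fun w => Complex.exp (w * conj z) := by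
  have hd : Differentiable ℂ fun w => Complex.exp (w * conj z) := by fun_prop
  refine ⟨hd, ?_⟩
  rw [memLp_two_iff_integrable_sq_norm (continuous_fockFun hd.continuous).aestronglyMeasurable]
  have h : Integrable fun w : ℂ => Real.exp (‖z‖ ^ 2) * Real.exp (-1 * ‖w + -z‖ ^ 2) :=
    ((integrable_exp_neg_mul_norm_sq one_pos).comp_add_right (-z)).const_mul _
  refine h.congr (Filter.Eventually.of_forall fun w => ?_)
  simp only
  rw [norm_fockFun, Complex.norm_exp, ← Real.exp_add, ← Real.exp_add, ← Real.exp_nat_mul,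
    add_comm w, norm_add_sq_plane]
  congr 1
  rw [norm_neg, map_neg, mul_neg, Complex.neg_re]
  push_cast
  ring

/-- The orthogonal projector onto the Bargmann-Fock space is given by the reproducing kernel. -/
theorem IsBargmannFockProj.integral_kernel {g p : PlaneL2} (h : IsBargmannFockProj g p)
    {P : ℂ → ℂ} (hP : IsFock P) (hp : (p : ℂ → ℂ) =ᵐ[volume] fockFun P) (z : ℂ) :
    ∫ w : ℂ, Complex.exp (z * conj w) * ((Real.exp (-‖w‖ ^ 2 / 2) : ℝ) : ℂ) * g w
      = Real.pi * P z := by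
  have hK := isFock_exp_mul_conj z
  -- Since `g - p` is orthogonal to the kernel function, `g` may be replaced by `p`, which the
  -- kernel reproduces.
  have horth := (Submodule.mem_orthogonal _ _).1 h.2 _ hK.toLp_mem_bargmannFock
  rw [inner_sub_right, sub_eq_zero, L2.inner_def, L2.inner_def] at horth
  rw [← hP.integral_reproducing z]
  have e : ∀ w, conj (fockFun (fun w => Complex.exp (w * conj z)) w)
      = Complex.exp (z * conj w) * ((Real.exp (-‖w‖ ^ 2 / 2) : ℝ) : ℂ) := by
    intro w
    rw [fockFun, map_mul, Complex.conj_ofReal, ← Complex.exp_conj, map_mul, Complex.conj_conj,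
      mul_comm (conj w)]
  refine Eq.trans (integral_congr_ae ?_) (horth.trans (integral_congr_ae ?_))
  · filter_upwards [hK.memLp.coeFn_toLp] with w hw
    rw [hw, RCLike.inner_apply', e]
  · filter_upwards [hK.memLp.coeFn_toLp, hp] with w hw hpw
    rw [hw, hpw, RCLike.inner_apply', e, fockFun]
    have : Real.exp (-‖w‖ ^ 2) = Real.exp (-‖w‖ ^ 2 / 2) * Real.exp (-‖w‖ ^ 2 / 2) := by
      rw [← Real.exp_add]
      ring_nf
    rw [this]
    push_cast
    ring

theorem memLp_fock_mul_mul {F₁ F₂ F₃ : ℂ → ℂ} (h₁ : IsFock F₁) (h₂ : IsFock F₂)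
    (h₃ : IsFock F₃) :
    MemLp (fun z => fockFun F₁ z * fockFun F₂ z * conj (fockFun F₃ z)) 2 volume := by
  obtain ⟨M₁, p₁, hM₁⟩ := h₁.exists_bound
  obtain ⟨M₂, p₂, hM₂⟩ := h₂.exists_bound
  have c₁ := h₁.continuous
  have c₂ := h₂.continuous
  have c₃ := h₃.continuous
  refine h₃.memLp.of_le_mul (c := M₁ * M₂) (Continuous.aestronglyMeasurable (by fun_prop))
    (Filter.Eventually.of_forall fun z => ?_)
  rw [norm_mul, norm_mul, RCLike.norm_conj]
  gcongr
  · exact hM₁ z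
  · exact hM₂ z

theorem crT_eq_proj {f₁ f₂ f₃ : PlaneL2} (m₁ : f₁ ∈ bargmannFock) (m₂ : f₂ ∈ bargmannFock)
    (m₃ : f₃ ∈ bargmannFock) :
    (∀ z : ℂ, Integrable (crIntegrand f₁ f₂ f₃ z) volume) ∧
      ∃ g p : PlaneL2,
        ((g : ℂ → ℂ) =ᵐ[volume] fun z => f₁ z * f₂ z * conj (f₃ z)) ∧
        IsBargmannFockProj g p ∧
        crT f₁ f₂ f₃ =ᵐ[volume] fun z => ((2 * Real.pi ^ 2 : ℝ) : ℂ) * p z := by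
  obtain ⟨F₁, h₁, e₁⟩ := exists_isFock_of_mem_bargmannFock m₁
  obtain ⟨F₂, h₂, e₂⟩ := exists_isFock_of_mem_bargmannFock m₂
  obtain ⟨F₃, h₃, e₃⟩ := exists_isFock_of_mem_bargmannFock m₃
  have hm : ∀ f : PlaneL2, Measurable f := fun f => (Lp.stronglyMeasurable f).measurable
  refine ⟨fun z => (h₁.integrable_crIntegrand h₂ h₃ z).congr (crIntegrand_ae_eq e₁ e₂ e₃ (hm f₁)
    (hm f₂) (hm f₃) h₁.continuous.measurable h₂.continuous.measurable h₃.continuous.measurable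
    z).symm, ?_⟩
  have hg := memLp_fock_mul_mul h₁ h₂ h₃
  obtain ⟨p, hp⟩ := exists_isBargmannFockProj (hg.toLp _)
  obtain ⟨P, hP, eP⟩ := exists_isFock_of_mem_bargmannFock hp.1
  refine ⟨hg.toLp _, p, ?_, hp, ?_⟩
  · filter_upwards [hg.coeFn_toLp, e₁, e₂, e₃] with z h0 h1 h2 h3
    rw [h0, h1, h2, h3]
  · filter_upwards [eP] with z hz
    have hk := hp.integral_kernel hP eP z
    rw [crT_congr_ae e₁ e₂ e₃, h₁.crT_eq_kernel h₂ h₃, hz, fockFun]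
    have hJ : ∫ u : ℂ, Complex.exp (z * conj u) * (F₁ u * F₂ u) * conj (F₃ u) *
          ((Real.exp (-2 * ‖u‖ ^ 2) : ℝ) : ℂ) = Real.pi * P z := by
      rw [← hk]
      refine integral_congr_ae ?_
      filter_upwards [hg.coeFn_toLp] with u hu
      -- One Gaussian factor belongs to the kernel function and one to each of the three Fock
      -- functions.
      have : Real.exp (-2 * ‖u‖ ^ 2) = Real.exp (-‖u‖ ^ 2 / 2) * Real.exp (-‖u‖ ^ 2 / 2) *
          Real.exp (-‖u‖ ^ 2 / 2) * Real.exp (-‖u‖ ^ 2 / 2) := by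
        rw [← Real.exp_add, ← Real.exp_add, ← Real.exp_add]
        ring_nf
      rw [hu, this]
      simp only [fockFun, map_mul, Complex.conj_ofReal]
      push_cast
      ring
    rw [hJ]
    push_cast
    ring

/-- The nonlinearity is determined as an `L²` class and its projection is unique, so the witnesses
in the Lowest Landau Level equation must be those supplied by `crT_eq_proj`. -/
theorem isCRSolution_iff_isLLLSolution {u : ℝ → PlaneL2} (hu : ∀ t : ℝ, u t ∈ bargmannFock) :
    IsCRSolution u ↔ IsLLLSolution (2 * Real.pi ^ 2) u := by
  have hcub : ∀ w : ℂ, w * w * conj w = ((‖w‖ ^ 2 : ℝ) : ℂ) * w := by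
    intro w
    rw [mul_assoc, Complex.mul_conj, Complex.normSq_eq_norm_sq, mul_comm]
  refine forall_congr' fun t => ?_
  obtain ⟨-, g, p, hg, hp, hT⟩ := crT_eq_proj (hu t) (hu t) (hu t)
  have hTp : ((((2 * Real.pi ^ 2 : ℝ) : ℂ) • p : PlaneL2) : ℂ → ℂ) =ᵐ[volume]
      crT (u t) (u t) (u t) := by
    filter_upwards [hT, Lp.coeFn_smul ((2 * Real.pi ^ 2 : ℝ) : ℂ) p] with z h1 h2
    rw [h1, h2, Pi.smul_apply, smul_eq_mul]
  constructor
  · rintro ⟨u', hd, he⟩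
    exact ⟨u', g, p, hd, by simpa only [hcub] using hg, hp, Lp.ext (he.trans hTp.symm)⟩
  · rintro ⟨u', N, q, hd, hN, hq, he⟩
    have hNg : N = g := Lp.ext (hN.trans (by simpa only [hcub] using hg.symm))
    subst hNg
    rw [hq.unique hp] at he
    exact ⟨u', hd, by rw [he]; exact hTp⟩

end Projection

/-! ### Gaussian moments and the explicit action on the basis `φ_n`. -/

section Basis

open scoped ComplexConjugate

theorem integral_norm_pow_mul_exp (j : ℕ) :
    ∫ w : ℂ, ‖w‖ ^ j * Real.exp (-‖w‖ ^ 2) = Real.pi * Real.Gamma ((j + 2 : ℝ) / 2) := by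
  have h := Complex.integral_rpow_mul_exp_neg_rpow (p := 2) (q := j) (by norm_num)
    (by have : (0 : ℝ) ≤ j := by positivity
        linarith)
  simp only [Real.rpow_natCast, Real.rpow_two] at h
  rw [h]
  ring

theorem integrable_norm_pow_mul_exp (j : ℕ) :
    Integrable fun w : ℂ => ‖w‖ ^ j * Real.exp (-‖w‖ ^ 2) :=
  Integrable.of_integral_ne_zero (by
    rw [integral_norm_pow_mul_exp]
    have := Real.Gamma_pos_of_pos (s := (j + 2 : ℝ) / 2) (by positivity)
    positivity)

theorem integrable_moment (k m : ℕ) :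
    Integrable fun w : ℂ => w ^ k * (conj w ^ m * ((Real.exp (-‖w‖ ^ 2) : ℝ) : ℂ)) := by
  refine (integrable_norm_pow_mul_exp (k + m)).mono' (Continuous.aestronglyMeasurable (by fun_prop))
    (Filter.Eventually.of_forall fun w => le_of_eq ?_)
  rw [norm_mul, norm_mul, norm_pow, norm_pow, RCLike.norm_conj, Complex.norm_real,
    Real.norm_eq_abs, Real.abs_exp, pow_add, mul_assoc]

/-- Factoring out `|w|^{2m}` leaves the entire function `w^{k-m}` against a radial weight, so only
its value at the origin counts. The case `k ≤ m` follows by conjugation. -/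
theorem integral_moment_of_le {k m : ℕ} (h : m ≤ k) :
    ∫ w : ℂ, w ^ k * (conj w ^ m * ((Real.exp (-‖w‖ ^ 2) : ℝ) : ℂ))
      = if k = m then (Real.pi * m.factorial : ℂ) else 0 := by
  have hpt : ∀ w : ℂ, w ^ k * (conj w ^ m * ((Real.exp (-‖w‖ ^ 2) : ℝ) : ℂ))
      = w ^ (k - m) * ((‖w‖ ^ (2 * m) * Real.exp (-‖w‖ ^ 2) : ℝ) : ℂ) := by
    intro w
    have hn : ((‖w‖ ^ 2 : ℝ) : ℂ) = w * conj w := by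
      rw [Complex.mul_conj, Complex.normSq_eq_norm_sq]
    rw [pow_mul, Complex.ofReal_mul, Complex.ofReal_pow _ m, hn, mul_pow]
    nth_rewrite 1 [← Nat.sub_add_cancel h]
    rw [pow_add]
    ring
  have hi := integrable_moment k m
  simp only [hpt] at hi ⊢
  rw [integral_entire_mul_radial (H := fun w => w ^ (k - m))
    (r := fun t => ((t ^ (2 * m) * Real.exp (-t ^ 2) : ℝ) : ℂ)) (by fun_prop) (by fun_prop) hi,
    integral_complex_ofReal, integral_norm_pow_mul_exp]
  have hG : Real.Gamma ((((2 * m : ℕ) : ℝ) + 2) / 2) = m.factorial := by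
    rw [← Real.Gamma_nat_eq_factorial]
    congr 1
    push_cast
    ring
  rw [hG]
  split_ifs with hkm
  · simp [hkm]
  · rw [zero_pow (by omega), zero_mul]

theorem integral_moment (k m : ℕ) :
    ∫ w : ℂ, w ^ k * (conj w ^ m * ((Real.exp (-‖w‖ ^ 2) : ℝ) : ℂ))
      = if k = m then (Real.pi * m.factorial : ℂ) else 0 := by
  rcases le_total m k with h | h
  · exact integral_moment_of_le h
  · have h1 := congrArg conj (integral_moment_of_le h)
    rw [← integral_conj] at h1
    have hpt : ∀ w : ℂ, conj (w ^ m * (conj w ^ k * ((Real.exp (-‖w‖ ^ 2) : ℝ) : ℂ)))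
        = w ^ k * (conj w ^ m * ((Real.exp (-‖w‖ ^ 2) : ℝ) : ℂ)) := by
      intro w
      simp only [map_mul, map_pow, Complex.conj_conj, Complex.conj_ofReal]
      ring
    simp only [hpt] at h1
    rw [h1]
    by_cases hkm : k = m
    · simp [hkm]
    · rw [if_neg hkm, if_neg (Ne.symm hkm), map_zero]

/-- The normalisation constant of `bfPhi n`. -/
noncomputable def bfCoeff (n : ℕ) : ℝ := 1 / Real.sqrt (Real.pi * (n.factorial : ℝ))

theorem bfPhi_eq_fockFun (n : ℕ) : bfPhi n = fockFun fun z => (bfCoeff n : ℂ) * z ^ n := rfl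

theorem bfCoeff_sq (n : ℕ) : bfCoeff n * bfCoeff n * (Real.pi * n.factorial) = 1 := by
  have h : 0 < Real.pi * (n.factorial : ℝ) := by positivity
  rw [bfCoeff, div_mul_div_comm, Real.mul_self_sqrt h.le]
  field_simp

theorem bfPhi_mul_conj (a b : ℕ) (z : ℂ) :
    bfPhi a z * conj (bfPhi b z) = (bfCoeff a * bfCoeff b : ℂ) *
      (z ^ a * (conj z ^ b * ((Real.exp (-‖z‖ ^ 2) : ℝ) : ℂ))) := by
  have h : Real.exp (-‖z‖ ^ 2) = Real.exp (-‖z‖ ^ 2 / 2) * Real.exp (-‖z‖ ^ 2 / 2) := by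
    rw [← Real.exp_add]
    ring_nf
  simp only [bfPhi_eq_fockFun, fockFun, map_mul, map_pow, Complex.conj_ofReal, h]
  push_cast
  ring

theorem integrable_bfPhi_mul_conj (a b : ℕ) :
    Integrable fun z => bfPhi a z * conj (bfPhi b z) := by
  simp only [bfPhi_mul_conj]
  exact (integrable_moment a b).const_mul _

theorem integral_bfPhi_mul_conj (a b : ℕ) :
    ∫ z, bfPhi a z * conj (bfPhi b z) = if a = b then 1 else 0 := by
  simp only [bfPhi_mul_conj]
  rw [integral_const_mul, integral_moment]
  split_ifs with h
  · subst h
    exact_mod_cast bfCoeff_sq a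
  · rw [mul_zero]

theorem isFock_bfPhi (n : ℕ) : IsFock fun z => (bfCoeff n : ℂ) * z ^ n := by
  have hd : Differentiable ℂ fun z => (bfCoeff n : ℂ) * z ^ n := by fun_prop
  refine ⟨hd, ?_⟩
  rw [memLp_two_iff_integrable_sq_norm (continuous_fockFun hd.continuous).aestronglyMeasurable]
  refine (integrable_bfPhi_mul_conj n n).norm.congr (Filter.Eventually.of_forall fun z => ?_)
  simp only [bfPhi_eq_fockFun, norm_mul, RCLike.norm_conj, sq]

/-- Expand `((z+w)/2)^{n₁+n₂}` binomially; moment orthogonality keeps only the power `w^{n₃}`. -/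
theorem crT_bfPhi (n₁ n₂ n₃ : ℕ) (z : ℂ) :
    crT (bfPhi n₁) (bfPhi n₂) (bfPhi n₃) z
      = Real.pi * ((Real.exp (-‖z‖ ^ 2 / 2) : ℝ) : ℂ) *
        (bfCoeff n₁ * bfCoeff n₂ * bfCoeff n₃ / 2 ^ (n₁ + n₂) *
        ∑ k ∈ Finset.range (n₁ + n₂ + 1), (z ^ (n₁ + n₂ - k) * ((n₁ + n₂).choose k : ℂ)) *
          if k = n₃ then (Real.pi * n₃.factorial : ℂ) else 0) := by
  simp only [bfPhi_eq_fockFun]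
  rw [(isFock_bfPhi n₁).crT_eq (isFock_bfPhi n₂) (isFock_bfPhi n₃)]
  congr 1
  -- The case distinction is turned back into moment integrals so that both sides are integrals in
  -- `w`.
  simp only [← integral_moment]
  simp only [← integral_const_mul]
  rw [← integral_finsetSum _ fun k _ => (integrable_moment k n₃).const_mul _, ← integral_const_mul]
  congr 1
  funext w
  have hb := add_pow w z (n₁ + n₂)
  have hs : ∑ k ∈ Finset.range (n₁ + n₂ + 1), (z ^ (n₁ + n₂ - k) * ((n₁ + n₂).choose k : ℂ)) *
      (w ^ k * (conj w ^ n₃ * ((Real.exp (-‖w‖ ^ 2) : ℝ) : ℂ)))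
      = (w + z) ^ (n₁ + n₂) * (conj w ^ n₃ * ((Real.exp (-‖w‖ ^ 2) : ℝ) : ℂ)) := by
    rw [hb, Finset.sum_mul]
    exact Finset.sum_congr rfl fun k _ => by ring
  rw [hs, map_mul, map_pow, Complex.conj_ofReal, add_comm w z, pow_add, pow_add, div_pow, div_pow]
  field_simp

theorem crAlpha_mul_bfCoeff (n₁ n₂ n₃ n₄ : ℕ) (h : n₁ + n₂ = n₃ + n₄) :
    Real.pi * (bfCoeff n₁ * bfCoeff n₂ * bfCoeff n₃ / 2 ^ (n₁ + n₂) *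
      (((n₁ + n₂).choose n₃ : ℝ) * (Real.pi * n₃.factorial)))
      = crAlpha n₁ n₂ n₃ n₄ * bfCoeff n₄ := by
  have hf : (((n₁ + n₂).choose n₃ : ℝ) * n₃.factorial) * n₄.factorial = (n₁ + n₂).factorial := by
    rw [h, Nat.choose_symm_add]
    exact_mod_cast Nat.add_choose_mul_factorial_mul_factorial n₃ n₄
  have hpi : Real.sqrt Real.pi ^ 2 = Real.pi := Real.sq_sqrt Real.pi_pos.le
  have h4 : Real.sqrt (n₄.factorial : ℝ) ^ 2 = n₄.factorial := Real.sq_sqrt (by positivity)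
  have hp : 0 < Real.sqrt Real.pi := Real.sqrt_pos.2 Real.pi_pos
  have hs : ∀ n : ℕ, 0 < Real.sqrt (n.factorial : ℝ) := fun n => Real.sqrt_pos.2 (by positivity)
  have s₁ := hs n₁
  have s₂ := hs n₂
  have s₃ := hs n₃
  have s₄ := hs n₄
  simp only [bfCoeff, crAlpha]
  rw [Real.sqrt_mul Real.pi_pos.le, Real.sqrt_mul Real.pi_pos.le, Real.sqrt_mul Real.pi_pos.le,
    Real.sqrt_mul Real.pi_pos.le, Real.sqrt_mul (by positivity), Real.sqrt_mul (by positivity),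
    -- The `n₄!` from the binomial coefficient is split as a square: one root goes to `crAlpha`, the
    -- other to `bfCoeff n₄`.
    Real.sqrt_mul (by positivity), ← hf, ← h4]
  field_simp
  simp only [h4, hpi]

theorem crT_bfPhi_of_eq {n₁ n₂ n₃ n₄ : ℕ} (h : n₁ + n₂ = n₃ + n₄) (z : ℂ) :
    crT (bfPhi n₁) (bfPhi n₂) (bfPhi n₃) z = (crAlpha n₁ n₂ n₃ n₄ : ℂ) * bfPhi n₄ z := by
  have hα := congrArg (fun t : ℝ => (t : ℂ)) (crAlpha_mul_bfCoeff n₁ n₂ n₃ n₄ h)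
  push_cast at hα
  rw [crT_bfPhi]
  simp only [mul_ite, mul_zero, Finset.sum_ite_eq', Finset.mem_range]
  rw [if_pos (by omega), show n₁ + n₂ - n₃ = n₄ by omega, bfPhi_eq_fockFun, fockFun]
  linear_combination (z ^ n₄ * ((Real.exp (-‖z‖ ^ 2 / 2) : ℝ) : ℂ)) * hα

theorem crT_bfPhi_of_lt {n₁ n₂ n₃ : ℕ} (h : n₁ + n₂ < n₃) (z : ℂ) :
    crT (bfPhi n₁) (bfPhi n₂) (bfPhi n₃) z = 0 := by
  rw [crT_bfPhi]
  simp only [mul_ite, mul_zero, Finset.sum_ite_eq', Finset.mem_range]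
  -- The degree `n₃` exceeds that of the binomial, so no term survives.
  rw [if_neg (by omega)]

theorem crE_bfPhi (n₁ n₂ n₃ n₄ : ℕ) :
    Integrable (fun z : ℂ => crT (bfPhi n₁) (bfPhi n₂) (bfPhi n₃) z * conj (bfPhi n₄ z)) volume ∧
      crE (bfPhi n₁) (bfPhi n₂) (bfPhi n₃) (bfPhi n₄)
        = if n₁ + n₂ = n₃ + n₄ then (crAlpha n₁ n₂ n₃ n₄ : ℂ) else 0 := by
  unfold crE
  rcases lt_or_ge (n₁ + n₂) n₃ with h | h
  · simp only [crT_bfPhi_of_lt h, zero_mul, integral_zero]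
    exact ⟨integrable_zero _ _ _, by rw [if_neg (by omega)]⟩
  · obtain ⟨m, hm⟩ := Nat.exists_eq_add_of_le h
    simp only [crT_bfPhi_of_eq hm, mul_assoc]
    refine ⟨(integrable_bfPhi_mul_conj m n₄).const_mul _, ?_⟩
    rw [integral_const_mul, integral_bfPhi_mul_conj]
    by_cases hmn : m = n₄
    · subst hmn
      rw [if_pos rfl, if_pos hm, mul_one]
    · rw [if_neg hmn, if_neg (by omega), mul_zero]

end Basis

theorem mainTheorem9 :
    (∀ (n₁ n₂ n₃ : ℕ) (z : ℂ),
      Integrable (crIntegrand (bfPhi n₁) (bfPhi n₂) (bfPhi n₃) z) volume) ∧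
    (∀ n₁ n₂ n₃ n₄ : ℕ, n₁ + n₂ = n₃ + n₄ → ∀ z : ℂ,
      crT (bfPhi n₁) (bfPhi n₂) (bfPhi n₃) z = (crAlpha n₁ n₂ n₃ n₄ : ℂ) * bfPhi n₄ z) ∧
    (∀ n₁ n₂ n₃ : ℕ, n₁ + n₂ < n₃ → ∀ z : ℂ,
      crT (bfPhi n₁) (bfPhi n₂) (bfPhi n₃) z = 0) ∧
    (∀ n₁ n₂ n₃ n₄ : ℕ,
      Integrable (fun z : ℂ => crT (bfPhi n₁) (bfPhi n₂) (bfPhi n₃) z *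
        (starRingEnd ℂ) (bfPhi n₄ z)) volume ∧
      crE (bfPhi n₁) (bfPhi n₂) (bfPhi n₃) (bfPhi n₄) =
        if n₁ + n₂ = n₃ + n₄ then (crAlpha n₁ n₂ n₃ n₄ : ℂ) else 0) ∧
    (∀ f₁ f₂ f₃ : PlaneL2, f₁ ∈ bargmannFock → f₂ ∈ bargmannFock → f₃ ∈ bargmannFock →
      (∀ z : ℂ, Integrable (crIntegrand f₁ f₂ f₃ z) volume) ∧
      ∃ g p : PlaneL2,
        ((g : ℂ → ℂ) =ᵐ[volume] fun z => f₁ z * f₂ z * (starRingEnd ℂ) (f₃ z)) ∧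
        IsBargmannFockProj g p ∧
        crT f₁ f₂ f₃ =ᵐ[volume] fun z => ((2 * Real.pi ^ 2 : ℝ) : ℂ) * p z) ∧
    (∀ u : ℝ → PlaneL2, (∀ t : ℝ, u t ∈ bargmannFock) →
      (IsCRSolution u ↔ IsLLLSolution (2 * Real.pi ^ 2) u)) :=
  ⟨fun n₁ n₂ n₃ z => (isFock_bfPhi n₁).integrable_crIntegrand (isFock_bfPhi n₂) (isFock_bfPhi n₃) z,
    fun _ _ _ _ h z => crT_bfPhi_of_eq h z, fun _ _ _ h z => crT_bfPhi_of_lt h z, crE_bfPhi,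
    fun _ _ _ m₁ m₂ m₃ => crT_eq_proj m₁ m₂ m₃, fun _ hu => isCRSolution_iff_isLLLSolution hu⟩
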